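/- Let $k$ be a field of characteristic zero. Let $\mathcal{G}$ be the category whose objects are finite groups and whose morphisms $G\to H$ are conjugacy classes of surjective group homomorphisms, where $\varphi,\psi\colon G\to H$ are conjugate if there is $h\in H$ with $\psi(g)=h\varphi(g)h^{-1}$ for all $g\in G$. Let $\mathcal{U}$ be a full and replete subcategory of $\mathcal{G}$ which is a multiplicative global family, that is: - (global family) if $G\in\mathcal{U}$ and $H\leq G$ is a subgroup, then $H\in\mathcal{U}$; and if $G\in\mathcal{U}$ and $G\to H$ is a surjective homomorphism, then $H\in\mathcal{U}$; - (multiplicative) the trivial group lies in $\mathcal{U}$, and $G\times H\in\mathcal{U}$ whenever $G,H\in\mathcal{U}$. Let $\mathcal{A}\mathcal{U}=[\mathcal{U}^{\mathrm{op}},\mathrm{Vect}_k]$ be the category of contravariant functors from $\mathcal{U}$ to $k$-vector spaces. For $G\in\mathcal{U}$ let $e_G\in\mathcal{A}\mathcal{U}$ be the functor $e_G(T)=k[\mathcal{U}(T,G)]$. For $X\in\mathcal{A}\mathcal{U}$, an element $x\in X(G)$ is called torsion if there are $H\in\mathcal{U}$ and a morphism $f\in\mathcal{U}(H,G)$ with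 $f^*(x)=0$, and $X$ is called torsion-free if it contains no nonzero torsion element. Then an object $X$ of $\mathcal{A}\mathcal{U}$ is projective if and only if it is torsion-free and injective. In particular, $e_G$ is injective for every $G\in\mathcal{U}$. -/

import Mathlib

open CategoryTheory Opposite

universe u

/-- A finite group, as an object of the category `𝒢` whose morphisms are conjugacy classes of
surjective homomorphisms. -/
structure OutGrp : Type 1 where
  /-- the underlying set -/
  carrier : Type
  [group : Group carrier]
  [finite : Finite carrier]

namespace OutGrp

instance : CoeSort OutGrp Type := ⟨OutGrp.carrier⟩

instance (G : OutGrp) : Group G := G.group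

instance (G : OutGrp) : Finite G := G.finite

/-- The object of `𝒢` given by a finite group. -/
abbrev of (G : Type) [Group G] [Finite G] : OutGrp := ⟨G⟩

/-- Surjective group homomorphisms `G → H`. -/
abbrev Epi (G H : OutGrp) : Type := {φ : G →* H // Function.Surjective φ}

/-- Two surjective homomorphisms `φ, ψ : G → H` are conjugate if `ψ = c_h ∘ φ` for some `h ∈ H`,
where `c_h x = h * x * h⁻¹`. -/
def conjSetoid (G H : OutGrp) : Setoid (Epi G H) where
  r φ ψ := ∃ h : H, ∀ g : G, ψ.1 g = h * φ.1 g * h⁻¹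
  iseqv :=
    { refl := fun φ => ⟨1, fun g => by simp⟩
      symm := by
        rintro φ ψ ⟨h, hh⟩
        exact ⟨h⁻¹, fun g => by rw [hh]; group⟩
      trans := by
        rintro φ ψ χ ⟨h, hh⟩ ⟨h', hh'⟩
        exact ⟨h' * h, fun g => by rw [hh', hh]; group⟩ }

/-- Morphisms `G ⟶ H` in `𝒢`: conjugacy classes of surjective homomorphisms. -/
def Hom (G H : OutGrp) : Type := Quotient (conjSetoid G H)

/-- The conjugacy class of a surjective homomorphism. -/
def Hom.mk {G H : OutGrp} (φ : G →* H) (hφ : Function.Surjective φ) : Hom G H :=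
  Quotient.mk (conjSetoid G H) ⟨φ, hφ⟩

/-- Composition of conjugacy classes, `[ψ] ∘ [φ] = [ψ ∘ φ]`. -/
def Hom.comp {G H K : OutGrp} (a : Hom G H) (b : Hom H K) : Hom G K :=
  Quotient.map₂ (sa := conjSetoid G H) (sb := conjSetoid H K) (sc := conjSetoid G K)
    (fun φ ψ => ⟨ψ.1.comp φ.1, ψ.2.comp φ.2⟩)
    (by
      rintro φ φ' ⟨h, hh⟩ ψ ψ' ⟨k, hk⟩
      refine ⟨k * ψ.1 h, fun g => ?_⟩
      simp only [MonoidHom.comp_apply, hh, hk, map_mul, map_inv]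
      group) a b

instance : Category OutGrp where
  Hom := Hom
  id G := Hom.mk (MonoidHom.id G) Function.surjective_id
  comp := Hom.comp
  id_comp := by
    rintro G H ⟨φ⟩
    rfl
  comp_id := by
    rintro G H ⟨φ⟩
    rfl
  assoc := by
    rintro G H K L ⟨φ⟩ ⟨ψ⟩ ⟨χ⟩
    rfl

/-- `U` (viewed as a full subcategory of `𝒢`) is subgroup-closed. -/
def IsSubgroupClosed (U : ObjectProperty OutGrp) : Prop :=
  ∀ (G : OutGrp) (H : Subgroup G), U G → U (of H)

/-- `U` is closed downwards: a quotient of a group in `U` is in `U`. In particular, `U` is replete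
(closed under isomorphism). -/
def IsClosedDownwards (U : ObjectProperty OutGrp) : Prop :=
  ∀ (G H : OutGrp) (φ : G →* H), Function.Surjective φ → U G → U H

/-- A global family is a subgroup-closed and downwards closed full subcategory of `𝒢`. -/
structure IsGlobalFamily (U : ObjectProperty OutGrp) : Prop where
  isSubgroupClosed : IsSubgroupClosed U
  isClosedDownwards : IsClosedDownwards U

/-- `U` is multiplicative: it contains the trivial group and is closed under binary products. -/
structure IsMultiplicative (U : ObjectProperty OutGrp) : Prop where
  one_mem : U (of Unit)
  prod_mem : ∀ G H : OutGrp, U G → U H → U (of (G × H))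

end OutGrp

/-- The category `𝒜𝒰 = [𝒰ᵒᵖ, Vect_k]` of contravariant functors from the full subcategory `U` of
`𝒢` to `k`-vector spaces. -/
abbrev AU (k : Type u) [Field k] (U : ObjectProperty OutGrp) : Type (max 1 (u + 1)) :=
  U.FullSubcategoryᵒᵖ ⥤ ModuleCat.{u} k

namespace AU

variable (k : Type u) [Field k] {U : ObjectProperty OutGrp}

/-- The generator `e_G`, with `e_G(T) = k[𝒰(T, G)]` and functoriality by precomposition. -/
noncomputable def e (G : U.FullSubcategory) : AU k U where
  obj T := ModuleCat.of k ((unop T ⟶ G) →₀ k)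
  map f := ModuleCat.ofHom (Finsupp.lmapDomain k k (fun a => f.unop ≫ a))
  map_id T := by
    ext : 1
    simp only [unop_id, Category.id_comp]
    exact Finsupp.lmapDomain_id k k
  map_comp f g := by
    ext : 1
    simp only [unop_comp, Category.assoc]
    exact Finsupp.lmapDomain_comp k k (fun a => f.unop ≫ a) (fun a => g.unop ≫ a)

variable {k}

/-- An element `x ∈ X(G)` is torsion if `f^*(x) = 0` for some morphism `f : H ⟶ G` in `𝒰`. -/
def IsTorsion (X : AU k U) {G : U.FullSubcategory} (x : X.obj (op G)) : Prop :=
  ∃ (H : U.FullSubcategory) (f : H ⟶ G), X.map f.op x = 0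

/-- `X` is torsion-free if it contains no nonzero torsion element. -/
def IsTorsionFree (X : AU k U) : Prop :=
  ∀ (G : U.FullSubcategory) (x : X.obj (op G)), IsTorsion X x → x = 0

end AU

/-! Summing copies of `e_S ⊗ V` over a skeleton gives the objects `free k U V`. They are projective,
they are torsion-free because all morphisms of `U` are epimorphisms, and every object is a quotient
of one. So the theorem reduces to two facts: `free k U V` is injective, and torsion-free objects
embed in such objects. Projective objects and torsion-free injective objects are then both the
retracts of free ones.

Both facts use `Col X H`, the colimit of `X` over all `W ⟶ H`. The family `U` contains relatively
free groups `F`, and by Gaschütz' lemma the number of surjective lifts of `F → W` to `F → W'` does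
not depend on the surjection. Averaging pullbacks over lifts therefore respects the relations of the
colimit, and questions about `Col X H` become questions about a single `X(F)`. Hence `Col` preserves
monomorphisms (`Col.map_injective`), and `X(H)` embeds in `Col X H` for `X` torsion-free
(`Col.ι_id_injective`).

Functionals on the `Col X S` should give maps `X ⟶ free k U V`, but taking `Col.ι a x` as
coefficient at `a` is not natural: the coefficient of `π^*x` must vanish when `a` does not factor
through `π`. Möbius inversion over the congruences of the target (equivalently, its normal
subgroups) corrects this in `coeff`; the vanishing is Weisner's theorem (`coeff_eq_zero`). -/

/-! ### Möbius functions and Weisner's theorem -/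

section Moebius

open Classical in
/-- On a finite join-semilattice with bottom there is a function with the sum property of
`M ↦ μ(⊥, M)`. -/
theorem exists_moebius (k : Type*) [Field k] (α : Type*) [Fintype α] [SemilatticeSup α]
    [OrderBot α] : ∃ μ : α → k, μ ⊥ = 1 ∧ ∀ m : α, m ≠ ⊥ → ∑ c with c ≤ m, μ c = 0 := by
  let μ : α → k := (wellFounded_lt (α := α)).fix
    (fun m ih => if m = ⊥ then 1 else -∑ c : {c // c < m}, ih c.1 c.2)
  have hμ : ∀ m, μ m = if m = ⊥ then 1 else -∑ c : {c // c < m}, μ c.1 := fun m =>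
    WellFounded.fix_eq _ _ _
  refine ⟨μ, by rw [hμ]; simp, fun m hm => ?_⟩
  have h : (Finset.univ.filter fun c : α => c ≤ m) =
      insert m (Finset.univ.filter fun c : α => c < m) := by
    ext c
    simp [le_iff_eq_or_lt]
  rw [h, Finset.sum_insert (by simp), hμ m, if_neg hm,
    Finset.sum_subtype (p := fun c : α => c < m) _ (by simp), neg_add_cancel]

variable {α : Type*} [Fintype α] [SemilatticeSup α] [OrderBot α]

open Classical in
/-- Weisner's theorem. -/
theorem sum_moebius_sup_eq_zero {k : Type*} [Field k] {μ : α → k}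
    (hμ : ∀ m : α, m ≠ ⊥ → ∑ c with c ≤ m, μ c = 0) {d : α} (hd : d ≠ ⊥) (m : α) :
    ∑ c with c ⊔ d = m, μ c = 0 := by
  induction m using (wellFounded_lt (α := α)).induction with
  | _ m ih =>
    -- The double sum runs over `c ⊔ d ≤ m`: all `c ≤ m` if `d ≤ m`, and nothing otherwise.
    -- Induction then removes the `m' < m`.
    have key : ∑ m' with m' ≤ m, ∑ c with c ⊔ d = m', μ c = 0 := by
      rw [← Finset.sum_biUnion]
      · have : ((Finset.univ.filter fun m' : α => m' ≤ m).biUnion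
            fun m' => Finset.univ.filter fun c => c ⊔ d = m') =
            Finset.univ.filter fun c => c ⊔ d ≤ m := by
          ext c
          simp
        rw [this]
        by_cases hdm : d ≤ m
        · have hm : m ≠ ⊥ := fun h => hd (le_bot_iff.1 (h ▸ hdm))
          rw [← hμ m hm]
          refine Finset.sum_congr ?_ fun _ _ => rfl
          ext c
          simp [hdm]
        · refine Finset.sum_eq_zero fun c hc => ?_
          simp [hdm] at hc
      · intro a _ b _ hab
        refine Finset.disjoint_left.2 fun c hc hc' => hab ?_
        simp only [Finset.mem_filter, Finset.mem_univ, true_and] at hc hc'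
        rw [← hc, ← hc']
    rw [← Finset.add_sum_erase _ _ (a := m) (by simp)] at key
    rwa [Finset.sum_eq_zero (s := Finset.erase _ _), add_zero] at key
    intro m' hm'
    simp only [Finset.mem_erase, Finset.mem_filter, Finset.mem_univ, true_and] at hm'
    exact ih m' (lt_of_le_of_ne hm'.2 hm'.1)

open Classical in
/-- If `g` only depends on the join with `d ≠ ⊥`, then `∑ μ(c) g(c)` vanishes. -/
theorem sum_moebius_smul_eq_zero {k M : Type*} [Field k] [AddCommGroup M] [Module k M] {μ : α → k}
    (hμ : ∀ m : α, m ≠ ⊥ → ∑ c with c ≤ m, μ c = 0) {d : α} (hd : d ≠ ⊥) (g : α → M)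
    (hg : ∀ c, g c = g (c ⊔ d)) : ∑ c, μ c • g c = 0 := by
  rw [← Finset.sum_fiberwise (s := Finset.univ) (g := fun c => c ⊔ d)]
  refine Finset.sum_eq_zero fun m _ => ?_
  rw [Finset.sum_congr rfl (g := fun c => μ c • g m), ← Finset.sum_smul,
    sum_moebius_sup_eq_zero hμ hd m, zero_smul]
  intro c hc
  rw [hg c, (Finset.mem_filter.1 hc).2]

end Moebius

/-! ### Gaschütz' lemma and relatively free groups -/

section Gaschuetz

variable {ι F W W' : Type*} [Group F] [Group W] [Group W']

/-- Each set is a product of fibres of `f` restricted to `H`, and any two fibres of a surjection of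
groups are translates of each other. -/
theorem card_lift_mem_eq (f : W' →* W) (H : Subgroup W') (hH : H.map f = ⊤) (t s : ι → W) :
    Nat.card {t' : ι → W' // ∀ i, t' i ∈ H ∧ f (t' i) = t i} =
      Nat.card {t' : ι → W' // ∀ i, t' i ∈ H ∧ f (t' i) = s i} := by
  have h : ∀ t : ι → W, Nat.card {t' : ι → W' // ∀ i, t' i ∈ H ∧ f (t' i) = t i} =
      Nat.card (∀ i, {w : H // f.comp H.subtype w = t i}) := fun t => Nat.card_congr
    { toFun := fun t' i => ⟨⟨t'.1 i, (t'.2 i).1⟩, (t'.2 i).2⟩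
      invFun := fun t' => ⟨fun i => (t' i).1.1, fun i => ⟨(t' i).1.2, (t' i).2⟩⟩
      left_inv := fun _ => rfl
      right_inv := fun _ => rfl }
  have hsurj : ∀ w, ∃ y, f.comp H.subtype y = w := fun w => by
    obtain ⟨y, hy, rfl⟩ : w ∈ H.map f := hH ▸ Subgroup.mem_top w
    exact ⟨⟨y, hy⟩, rfl⟩
  rw [h, h]
  choose a ha using hsurj
  refine Nat.card_congr (Equiv.piCongrRight fun i =>
    { toFun := fun w => ⟨w.1 * ((a (t i))⁻¹ * a (s i)), by
        rw [map_mul, map_mul, map_inv, w.2, ha, ha]; group⟩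
      invFun := fun w => ⟨w.1 * ((a (s i))⁻¹ * a (t i)), by
        rw [map_mul, map_mul, map_inv, w.2, ha, ha]; group⟩
      left_inv := fun w => Subtype.ext (by simp [mul_assoc])
      right_inv := fun w => Subtype.ext (by simp [mul_assoc]) })

/-- Gaschütz' lemma: the number of lifts of a generating tuple which generate a given subgroup does
not depend on the tuple. -/
theorem card_generating_lift_eq [Finite ι] [Finite W'] (f : W' →* W) {t s : ι → W}
    (ht : Subgroup.closure (Set.range t) = ⊤) (hs : Subgroup.closure (Set.range s) = ⊤)
    (H : Subgroup W') :
    Nat.card {t' : ι → W' // Subgroup.closure (Set.range t') = H ∧ ∀ i, f (t' i) = t i} =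
      Nat.card {t' : ι → W' // Subgroup.closure (Set.range t') = H ∧ ∀ i, f (t' i) = s i} := by
  have empty : ∀ (H : Subgroup W'), H.map f ≠ ⊤ → ∀ t : ι → W,
      Subgroup.closure (Set.range t) = ⊤ →
      IsEmpty {t' : ι → W' // Subgroup.closure (Set.range t') = H ∧ ∀ i, f (t' i) = t i} := by
    intro H hH t ht
    refine ⟨fun t' => hH ?_⟩
    rw [← t'.2.1, MonoidHom.map_closure, ← Set.range_comp, ← ht]
    congr
    funext i
    exact t'.2.2 i
  have split : ∀ (H : Subgroup W') (t : ι → W),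
      Nat.card {t' : ι → W' // ∀ i, t' i ∈ H ∧ f (t' i) = t i} =
      ∑ᶠ K : {K : Subgroup W' // K ≤ H},
        Nat.card {t' : ι → W' // Subgroup.closure (Set.range t') = K ∧ ∀ i, f (t' i) = t i} := by
    intro H t
    have := Fintype.ofFinite {K : Subgroup W' // K ≤ H}
    rw [finsum_eq_sum_of_fintype, ← Nat.card_sigma]
    refine Nat.card_congr
      { toFun := fun t' => ⟨⟨Subgroup.closure (Set.range t'.1), by
          rw [Subgroup.closure_le]
          rintro _ ⟨i, rfl⟩
          exact (t'.2 i).1⟩, t'.1, rfl, fun i => (t'.2 i).2⟩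
        invFun := fun p => ⟨p.2.1, fun i => ⟨p.1.2 (p.2.2.1.le
          (Subgroup.subset_closure ⟨i, rfl⟩)), p.2.2.2 i⟩⟩
        left_inv := fun _ => rfl
        right_inv := by
          rintro ⟨⟨K, hK⟩, t', h', h⟩
          dsimp only at h'
          subst h'
          rfl }
  -- Sorting lifts in `H` by the subgroup they generate, the total does not depend on the tuple, and
  -- by induction neither do the parts for proper subgroups; cancelling leaves the part for `H`.
  induction H using (wellFounded_lt (α := Subgroup W')).induction with
  | _ H ih =>
    by_cases hH : H.map f = ⊤
    · have h := card_lift_mem_eq f H hH t s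
      rw [split, split] at h
      classical
      have := Fintype.ofFinite {K : Subgroup W' // K ≤ H}
      rw [finsum_eq_sum_of_fintype, finsum_eq_sum_of_fintype,
        ← Finset.add_sum_erase _ _ (Finset.mem_univ ⟨H, le_rfl⟩),
        ← Finset.add_sum_erase _ _ (Finset.mem_univ ⟨H, le_rfl⟩)] at h
      rw [Finset.sum_congr rfl (fun K hK => ih K.1 (lt_of_le_of_ne K.2
        fun h => (Finset.mem_erase.1 hK).1 (Subtype.ext h)))] at h
      exact Nat.add_right_cancel h
    · have := empty H hH t ht
      have := empty H hH s hs
      simp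

/-- The elements `e` of `F` generate, and every tuple in `W` is the image of `e` under a
homomorphism. -/
structure IsRelFree (e : ι → F) (W : Type*) [Group W] : Prop where
  closure_eq : Subgroup.closure (Set.range e) = ⊤
  exists_hom : ∀ t : ι → W, ∃ p : F →* W, ∀ i, p (e i) = t i

theorem surjective_iff_closure {e : ι → F} (he : Subgroup.closure (Set.range e) = ⊤)
    (p : F →* W) :
    Function.Surjective p ↔ Subgroup.closure (Set.range fun i => p (e i)) = ⊤ := by
  rw [← MonoidHom.range_eq_top, MonoidHom.range_eq_map, ← he, MonoidHom.map_closure,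
    ← Set.range_comp]
  rfl

/-- The number of surjective lifts through `f` of a surjection from a relatively free group. -/
theorem IsRelFree.card_lift_eq [Finite ι] [Finite W'] {e : ι → F} (he : IsRelFree e W')
    (f : W' →* W)
    {q r : F →* W} (hq : Function.Surjective q) (hr : Function.Surjective r) :
    Nat.card {p : F →* W' // Function.Surjective p ∧ f.comp p = q} =
      Nat.card {p : F →* W' // Function.Surjective p ∧ f.comp p = r} := by
  have h : ∀ q : F →* W, Nat.card {p : F →* W' // Function.Surjective p ∧ f.comp p = q} =
      Nat.card {t' : ι → W' // Subgroup.closure (Set.range t') = ⊤ ∧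
        ∀ i, f (t' i) = q (e i)} := by
    intro q
    refine Nat.card_congr (Equiv.ofBijective (fun p => ⟨fun i => p.1 (e i),
      (surjective_iff_closure he.closure_eq _).1 p.2.1, fun i => DFunLike.congr_fun p.2.2 (e i)⟩)
      ⟨fun p p' h => Subtype.ext (MonoidHom.eq_of_eqOn_dense he.closure_eq ?_), fun t => ?_⟩)
    · rintro _ ⟨i, rfl⟩
      exact congrFun (congrArg Subtype.val h) i
    · obtain ⟨p, hp⟩ := he.exists_hom t.1
      have hpt : (fun i => p (e i)) = t.1 := funext hp
      refine ⟨⟨p, (surjective_iff_closure he.closure_eq _).2 (hpt ▸ t.2.1),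
        MonoidHom.eq_of_eqOn_dense he.closure_eq ?_⟩, Subtype.ext hpt⟩
      rintro _ ⟨i, rfl⟩
      simp [hp, t.2.2]
  rw [h, h]
  exact card_generating_lift_eq f ((surjective_iff_closure he.closure_eq _).1 hq)
    ((surjective_iff_closure he.closure_eq _).1 hr) ⊤

/-- Every surjection from a relatively free group lifts to a surjection, provided the target has
sufficiently few generators. -/
theorem IsRelFree.exists_surjective_lift [Finite ι] [Finite W'] {e : ι → F}
    (he : IsRelFree e W') {f : W' →* W}
    (hf : Function.Surjective f) {q : F →* W} (hq : Function.Surjective q)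
    (hW' : ∃ t : ι → W', Subgroup.closure (Set.range t) = ⊤) :
    ∃ p : F →* W', Function.Surjective p ∧ f.comp p = q := by
  obtain ⟨t, ht⟩ := hW'
  obtain ⟨p, hp⟩ := he.exists_hom t
  have hpt : (fun i => p (e i)) = t := funext hp
  have hps : Function.Surjective p := (surjective_iff_closure he.closure_eq _).2 (hpt ▸ ht)
  have hfin : Finite (F →* W') := Finite.of_injective (fun p i => p (e i)) fun p p' h =>
    MonoidHom.eq_of_eqOn_dense he.closure_eq (by
      rintro _ ⟨i, rfl⟩
      exact congrFun h i)
  -- Existence by counting: `f.comp p` has the surjective lift `p`, so `q` has equally many, hence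
  -- some.
  have h := he.card_lift_eq f hq (r := f.comp p) (hf.comp hps)
  have hne : Nonempty {p' : F →* W' // Function.Surjective p' ∧ f.comp p' = f.comp p} :=
    ⟨⟨p, hps, rfl⟩⟩
  have hpos := Nat.card_pos (α := {p' : F →* W' // Function.Surjective p' ∧ f.comp p' = f.comp p})
  rw [← h] at hpos
  obtain ⟨⟨p', h1, h2⟩⟩ := (Nat.card_pos_iff.1 hpos).1
  exact ⟨p', h1, h2⟩

end Gaschuetz

/-! ### Relatively free groups inside `U` -/

namespace OutGrp

variable {U : ObjectProperty OutGrp}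

theorem IsClosedDownwards.of_mulEquiv (h : IsClosedDownwards U) {G H : OutGrp} (e : G ≃* H)
    (hG : U G) : U H :=
  h G H e.toMonoidHom e.surjective hG

theorem pi_mem (hglobal : IsGlobalFamily U) (hmul : IsMultiplicative U) {B : OutGrp} (hB : U B)
    (ι : Type) [Finite ι] : U (of (ι → B)) := by
  have hfin : ∀ n : ℕ, U (of (Fin n → B)) := by
    intro n
    induction n with
    | zero =>
      exact hglobal.isClosedDownwards (of Unit) (of (Fin 0 → B)) 1
        (fun x => ⟨1, Subsingleton.elim _ _⟩) hmul.one_mem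
    | succ n ih =>
      exact hglobal.isClosedDownwards (of (B × (Fin n → B))) (of (Fin (n + 1) → B))
        { toFun := fun p => Fin.cons p.1 p.2
          map_one' := by
            funext i
            refine Fin.cases rfl (fun i => rfl) i
          map_mul' := fun p q => by
            funext i
            refine Fin.cases ?_ (fun i => ?_) i <;> simp }
        (fun x => ⟨(x 0, fun i => x i.succ), by
          funext i
          refine Fin.cases ?_ (fun i => ?_) i <;> simp⟩) (hmul.prod_mem _ _ hB ih)
  obtain ⟨n, ⟨eqv⟩⟩ := Finite.exists_equiv_fin ι
  exact hglobal.isClosedDownwards (of (Fin n → B)) (of (ι → B))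
    { toFun := fun x i => x (eqv i)
      map_one' := rfl
      map_mul' := fun _ _ => rfl }
    (fun x => ⟨fun i => x (eqv.symm i), by funext i; simp⟩) (hfin n)

/-- Finitely many groups in `U` are retracts of a single group in `U`. -/
theorem exists_common_retract (hmul : IsMultiplicative U) (s : List U.FullSubcategory) :
    ∃ B : OutGrp, U B ∧ ∀ W ∈ s, ∃ (r : B →* W.obj) (i : W.obj →* B), ∀ w, r (i w) = w := by
  induction s with
  | nil => exact ⟨_, hmul.one_mem, by simp⟩
  | cons W s ih =>
    obtain ⟨B, hB, h⟩ := ih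
    refine ⟨of (W.obj × B), hmul.prod_mem _ _ W.property hB, ?_⟩
    intro W' hW'
    rcases List.mem_cons.1 hW' with rfl | hW'
    · exact ⟨MonoidHom.fst _ _, MonoidHom.inl _ _, fun _ => rfl⟩
    · obtain ⟨r, i, hri⟩ := h W' hW'
      exact ⟨r.comp (MonoidHom.snd _ _), (MonoidHom.inr _ _).comp i, hri⟩

/-- The subgroup of `B^(B^B)` generated by the evaluations `ev b` is relatively free for `B`:
projection to the coordinate `t` sends `ev b` to `t b`. Retractions of `B` carry this over to every
group in the list. -/
theorem exists_isRelFree (hglobal : IsGlobalFamily U) (hmul : IsMultiplicative U)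
    (s : List U.FullSubcategory) :
    ∃ (ι : Type) (_ : Finite ι) (F : U.FullSubcategory) (e : ι → F.obj),
      ∀ W ∈ s, IsRelFree e W.obj ∧ ∃ t : ι → W.obj, Subgroup.closure (Set.range t) = ⊤ := by
  obtain ⟨B, hB, h⟩ := exists_common_retract hmul s
  let ev : B → ((B → B) → B) := fun b t => t b
  let K : Subgroup ((B → B) → B) := Subgroup.closure (Set.range ev)
  let e : B → K := fun b => ⟨ev b, Subgroup.subset_closure ⟨b, rfl⟩⟩
  have he : Subgroup.closure (Set.range e) = ⊤ := by
    have : Set.range e = ((↑) : K → ((B → B) → B)) ⁻¹' Set.range ev := by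
      ext x
      constructor
      · rintro ⟨b, rfl⟩
        exact ⟨b, rfl⟩
      · rintro ⟨b, hb⟩
        exact ⟨b, Subtype.ext hb⟩
    rw [this]
    exact Subgroup.closure_closure_coe_preimage
  refine ⟨B, inferInstance, ⟨of K, hglobal.isSubgroupClosed _ _ (pi_mem hglobal hmul hB _)⟩, e,
    fun W hW => ?_⟩
  obtain ⟨r, i, hri⟩ := h W hW
  refine ⟨⟨he, fun t => ⟨(r.comp (Pi.evalMonoidHom (fun _ : B → B => (B : Type))
    fun b => i (t b))).comp K.subtype, fun b => hri _⟩⟩, r, ?_⟩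
  rw [Function.Surjective.range_eq fun w => ⟨i w, hri w⟩, Subgroup.closure_univ]

end OutGrp

/-! ### Morphisms of `U` as classes of surjections -/

namespace OutGrp

variable {U : ObjectProperty OutGrp}

/-- The morphism of `U` given by a surjective homomorphism. -/
def homOf {G H : U.FullSubcategory} (φ : G.obj →* H.obj) (hφ : Function.Surjective φ) : G ⟶ H :=
  ObjectProperty.homMk (Hom.mk φ hφ)

theorem exists_homOf_eq {G H : U.FullSubcategory} (f : G ⟶ H) :
    ∃ (φ : G.obj →* H.obj) (hφ : Function.Surjective φ), homOf φ hφ = f := by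
  obtain ⟨f⟩ := f
  obtain ⟨φ, hφ⟩ := f
  exact ⟨φ, hφ, rfl⟩

theorem homOf_eq_iff {G H : U.FullSubcategory} {φ ψ : G.obj →* H.obj}
    {hφ : Function.Surjective φ} {hψ : Function.Surjective ψ} :
    homOf φ hφ = homOf ψ hψ ↔ ∃ h : H.obj, ∀ g, ψ g = h * φ g * h⁻¹ := by
  constructor
  · intro h
    exact Quotient.exact (s := conjSetoid G.obj H.obj) (congrArg InducedCategory.Hom.hom h)
  · intro h
    exact ObjectProperty.hom_ext _ (Quotient.sound (s := conjSetoid G.obj H.obj) h)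

theorem homOf_comp {G H K : U.FullSubcategory} {φ : G.obj →* H.obj} {ψ : H.obj →* K.obj}
    {hφ : Function.Surjective φ} {hψ : Function.Surjective ψ} :
    homOf φ hφ ≫ homOf ψ hψ = homOf (ψ.comp φ) (hψ.comp hφ) :=
  rfl

theorem homOf_id {G : U.FullSubcategory} :
    homOf (MonoidHom.id G.obj) Function.surjective_id = 𝟙 G :=
  rfl

instance {G H : U.FullSubcategory} (f : G ⟶ H) : CategoryTheory.Epi f where
  left_cancellation {K} a b h := by
    obtain ⟨φ, hφ, rfl⟩ := exists_homOf_eq f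
    obtain ⟨α, hα, rfl⟩ := exists_homOf_eq a
    obtain ⟨β, hβ, rfl⟩ := exists_homOf_eq b
    rw [homOf_comp, homOf_comp, homOf_eq_iff] at h
    obtain ⟨k, hk⟩ := h
    refine homOf_eq_iff.2 ⟨k, fun x => ?_⟩
    obtain ⟨y, rfl⟩ := hφ x
    exact hk y

instance (G H : OutGrp) : Finite (G →* H) := DFunLike.finite _

instance {G H : U.FullSubcategory} : Finite (G ⟶ H) :=
  Finite.of_surjective
    (fun φ : {φ : G.obj →* H.obj // Function.Surjective φ} => homOf φ.1 φ.2) fun f => by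
      obtain ⟨φ, hφ, rfl⟩ := exists_homOf_eq f
      exact ⟨⟨φ, hφ⟩, rfl⟩

/-- An isomorphism of groups is an isomorphism in `U`. -/
def isoOf {G H : U.FullSubcategory} (e : G.obj ≃* H.obj) : G ≅ H where
  hom := homOf e.toMonoidHom e.surjective
  inv := homOf e.symm.toMonoidHom e.symm.surjective
  hom_inv_id := homOf_comp.trans (homOf_eq_iff.2 ⟨1, fun g => by simp⟩)
  inv_hom_id := homOf_comp.trans (homOf_eq_iff.2 ⟨1, fun g => by simp⟩)

end OutGrp

namespace AU

open OutGrp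

variable {k : Type u} [Field k] {U : ObjectProperty OutGrp}

theorem map_comp_apply (X : AU k U) {A B C : U.FullSubcategory} (f : A ⟶ B) (g : B ⟶ C)
    (x : X.obj (op C)) : X.map (f ≫ g).op x = X.map f.op (X.map g.op x) := by
  rw [op_comp, X.map_comp]
  rfl

theorem map_id_apply (X : AU k U) {A : U.FullSubcategory} (x : X.obj (op A)) :
    X.map (𝟙 A).op x = x := by
  rw [op_id, X.map_id]
  rfl

theorem naturality_apply {X Y : AU k U} (θ : X ⟶ Y) {A B : U.FullSubcategory} (f : A ⟶ B)
    (x : X.obj (op B)) :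
    θ.app (op A) (X.map f.op x) = Y.map f.op (θ.app (op B) x) := by
  exact congrArg (fun h => h.hom x) (θ.naturality f.op)

theorem mono_iff {X Y : AU k U} (θ : X ⟶ Y) :
    Mono θ ↔ ∀ A : U.FullSubcategory, Function.Injective (θ.app (op A)) := by
  rw [NatTrans.mono_iff_mono_app]
  simp only [ModuleCat.mono_iff_injective]
  exact ⟨fun h A => h (op A), fun h A => h A.unop⟩

theorem epi_iff {X Y : AU k U} (θ : X ⟶ Y) :
    Epi θ ↔ ∀ A : U.FullSubcategory, Function.Surjective (θ.app (op A)) := by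
  rw [NatTrans.epi_iff_epi_app]
  simp only [ModuleCat.epi_iff_surjective]
  exact ⟨fun h A => h (op A), fun h A => h A.unop⟩

end AU

/-! ### Colimits over comma categories and their exactness -/

namespace AU

open OutGrp

variable {k : Type u} [Field k] {U : ObjectProperty OutGrp}

/-- The direct sum of all `X(W)` over objects `α : W ⟶ H` of the comma category. -/
abbrev Pre (X : AU k U) (H : U.FullSubcategory) : Type (max 1 u) :=
  DirectSum (Σ W : U.FullSubcategory, (W ⟶ H)) fun p => X.obj (op p.1)

namespace Pre

variable {X Y : AU k U} {H : U.FullSubcategory}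

open Classical in
/-- The inclusion of a summand. -/
noncomputable def incl {W : U.FullSubcategory} (α : W ⟶ H) : X.obj (op W) →ₗ[k] Pre X H :=
  DirectSum.lof k (Σ W : U.FullSubcategory, (W ⟶ H)) (fun p => X.obj (op p.1)) ⟨W, α⟩

open Classical in
/-- A linear map out of the direct sum. -/
noncomputable def desc {V : Type*} [AddCommGroup V] [Module k V]
    (f : ∀ {W : U.FullSubcategory} (_ : W ⟶ H), X.obj (op W) →ₗ[k] V) : Pre X H →ₗ[k] V :=
  DirectSum.toModule k _ V fun p => f p.2

@[simp]
theorem desc_incl {V : Type*} [AddCommGroup V] [Module k V]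
    (f : ∀ {W : U.FullSubcategory} (_ : W ⟶ H), X.obj (op W) →ₗ[k] V)
    {W : U.FullSubcategory} (α : W ⟶ H) (x : X.obj (op W)) : desc f (incl α x) = f α x := by
  classical
  exact DirectSum.toModule_lof k (φ := fun p : Σ W : U.FullSubcategory, (W ⟶ H) => f p.2)
    ⟨W, α⟩ x

theorem induction_on {p : Pre X H → Prop} (b : Pre X H) (zero : p 0)
    (incl : ∀ {W : U.FullSubcategory} (α : W ⟶ H) (x : X.obj (op W)), p (incl α x))
    (add : ∀ a b, p a → p b → p (a + b)) : p b := by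
  classical
  exact DirectSum.induction_on b zero (fun i x => incl i.2 x) add

variable (X H) in
/-- The relations defining the colimit over the comma category. -/
def rel : Submodule k (Pre X H) :=
  Submodule.span k {r | ∃ (W' W : U.FullSubcategory) (f : W' ⟶ W) (α : W ⟶ H)
    (x : X.obj (op W)), r = incl (f ≫ α) (X.map f.op x) - incl α x}

/-- Functoriality of `Pre`. -/
noncomputable def map (θ : X ⟶ Y) : Pre X H →ₗ[k] Pre Y H :=
  desc fun {W} α => incl α ∘ₗ (θ.app (op W)).hom

/-- Surjective homomorphisms `F → W` over `H`. -/
abbrev Lift {F W : U.FullSubcategory} (φ : F ⟶ H) (α : W ⟶ H) : Type :=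
  {q : F.obj →* W.obj // ∃ hq : Function.Surjective q, homOf q hq ≫ α = φ}

/-- The morphism given by a lift. -/
def Lift.hom {F W : U.FullSubcategory} {φ : F ⟶ H} {α : W ⟶ H} (q : Lift φ α) : F ⟶ W :=
  homOf q.1 q.2.1

theorem Lift.hom_comp {F W : U.FullSubcategory} {φ : F ⟶ H} {α : W ⟶ H} (q : Lift φ α) :
    q.hom ≫ α = φ :=
  q.2.2

noncomputable instance {F W : U.FullSubcategory} (φ : F ⟶ H) (α : W ⟶ H) :
    Fintype (Lift φ α) :=
  Fintype.ofFinite _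

variable (X) in
/-- The average of the pullbacks along all lifts. -/
noncomputable def average {F W : U.FullSubcategory} (φ : F ⟶ H) (α : W ⟶ H) :
    X.obj (op W) →ₗ[k] X.obj (op F) :=
  (Fintype.card (Lift φ α) : k)⁻¹ • ∑ q : Lift φ α, (X.map q.hom.op).hom

theorem average_apply {F W : U.FullSubcategory} (φ : F ⟶ H) (α : W ⟶ H) (x : X.obj (op W)) :
    average X φ α x = (Fintype.card (Lift φ α) : k)⁻¹ • ∑ q : Lift φ α, X.map q.hom.op x := by
  simp [average]

/-- `F` is relatively free with respect to the groups in the list `s`, on sufficiently many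
generators. -/
def IsGood (s : List U.FullSubcategory) (F : U.FullSubcategory) : Prop :=
  ∃ (ι : Type) (_ : Finite ι) (e : ι → F.obj), ∀ W ∈ s, IsRelFree e W.obj ∧
    ∃ t : ι → W.obj, Subgroup.closure (Set.range t) = ⊤

theorem IsGood.mono {s s' : List U.FullSubcategory} {F : U.FullSubcategory} (h : IsGood s' F)
    (hs : s ⊆ s') : IsGood s F := by
  obtain ⟨ι, hι, e, he⟩ := h
  exact ⟨ι, hι, e, fun W hW => he W (hs hW)⟩

theorem exists_isGood (hglobal : IsGlobalFamily U) (hmul : IsMultiplicative U)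
    (s : List U.FullSubcategory) : ∃ F, IsGood s F := by
  obtain ⟨ι, hι, F, e, h⟩ := exists_isRelFree hglobal hmul s
  exact ⟨F, ι, hι, e, h⟩

theorem IsGood.exists_hom {s : List U.FullSubcategory} {F : U.FullSubcategory} (h : IsGood s F)
    (hH : H ∈ s) : Nonempty (F ⟶ H) := by
  obtain ⟨ι, hι, e, he⟩ := h
  obtain ⟨he, t, ht⟩ := he H hH
  obtain ⟨p, hp⟩ := he.exists_hom t
  have hpt : (fun i => p (e i)) = t := funext hp
  exact ⟨homOf p ((surjective_iff_closure he.closure_eq _).2 (hpt ▸ ht))⟩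

theorem IsGood.nonempty_lift {s : List U.FullSubcategory} {F W : U.FullSubcategory}
    (h : IsGood s F) (hW : W ∈ s) (φ : F ⟶ H) (α : W ⟶ H) : Nonempty (Lift φ α) := by
  obtain ⟨ι, hι, e, he⟩ := h
  obtain ⟨he, t, ht⟩ := he W hW
  obtain ⟨φ, hφ, rfl⟩ := exists_homOf_eq φ
  obtain ⟨a, ha, rfl⟩ := exists_homOf_eq α
  obtain ⟨p, hp, h⟩ := he.exists_surjective_lift ha hφ ⟨t, ht⟩
  exact ⟨p, hp, by subst h; rfl⟩

/-- Composition with `f` sends lifts to `W'` to lifts to `W`. By Gaschütz' lemma all its fibres have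
the same size `C`, which is nonzero in `k`, so the two averages agree. -/
theorem average_comp [CharZero k] {s : List U.FullSubcategory} {F W W' : U.FullSubcategory}
    (h : IsGood s F) (hW' : W' ∈ s) (φ : F ⟶ H) (f : W' ⟶ W) (α : W ⟶ H) (x : X.obj (op W)) :
    average X φ (f ≫ α) (X.map f.op x) = average X φ α x := by
  classical
  obtain ⟨q₀⟩ := h.nonempty_lift hW' φ (f ≫ α)
  obtain ⟨ι, hι, e, he⟩ := h
  obtain ⟨he, -⟩ := he W' hW'
  obtain ⟨g, hg, rfl⟩ := exists_homOf_eq f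
  let p : Lift φ (homOf g hg ≫ α) → Lift φ α := fun q =>
    ⟨g.comp q.1, hg.comp q.2.1, by
      rw [← homOf_comp (hφ := q.2.1) (hψ := hg), Category.assoc]
      exact q.2.2⟩
  have hfib : ∀ q : Lift φ α, Fintype.card {q' // p q' = q} =
      Nat.card {r : F.obj →* W'.obj // Function.Surjective r ∧ g.comp r = q.1} := by
    intro q
    rw [← Nat.card_eq_fintype_card]
    refine Nat.card_congr
      { toFun := fun q' => ⟨q'.1.1, q'.1.2.1, congrArg Subtype.val q'.2⟩
        invFun := fun r => ⟨⟨r.1, r.2.1, ?_⟩, Subtype.ext r.2.2⟩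
        left_inv := fun _ => rfl
        right_inv := fun _ => rfl }
    obtain ⟨r, hr, hrq⟩ := r
    obtain ⟨q, hq, hqα⟩ := q
    dsimp only at hrq
    subst hrq
    refine Eq.trans ?_ hqα
    rw [← Category.assoc, homOf_comp]
  set C := Fintype.card {q' // p q' = p q₀} with hC
  have hconst : ∀ q : Lift φ α, (Finset.univ.filter fun q' => p q' = q).card = C := by
    intro q
    rw [← Fintype.card_subtype, hC, hfib, hfib]
    exact he.card_lift_eq g q.2.1 (p q₀).2.1
  have hC0 : (C : k) ≠ 0 := by
    rw [Nat.cast_ne_zero]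
    have : Nonempty {q' // p q' = p q₀} := ⟨⟨q₀, rfl⟩⟩
    exact Fintype.card_ne_zero
  have hcard : Fintype.card (Lift φ (homOf g hg ≫ α)) = Fintype.card (Lift φ α) * C := by
    rw [← Finset.card_univ, Finset.card_eq_sum_card_fiberwise (f := p) (t := Finset.univ)
      (fun _ _ => Finset.mem_univ _), Finset.sum_congr rfl fun q _ => hconst q]
    simp
  have hsum : ∑ q : Lift φ (homOf g hg ≫ α), X.map q.hom.op (X.map (homOf g hg).op x) =
      (C : k) • ∑ q : Lift φ α, X.map q.hom.op x := by
    have : ∀ q : Lift φ (homOf g hg ≫ α), X.map q.hom.op (X.map (homOf g hg).op x) =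
        X.map (p q).hom.op x := fun q => (map_comp_apply X _ _ x).symm
    rw [Finset.sum_congr rfl fun q _ => this q,
      ← Finset.sum_fiberwise' Finset.univ p fun q => X.map q.hom.op x, Finset.smul_sum]
    refine Finset.sum_congr rfl fun q _ => ?_
    rw [Finset.sum_const, hconst, Nat.cast_smul_eq_nsmul]
  rw [average_apply, average_apply, hsum, hcard, smul_smul]
  congr 1
  push_cast
  field_simp

variable (X) in
/-- The averaging map. -/
noncomputable def averageMap {F : U.FullSubcategory} (φ : F ⟶ H) : Pre X H →ₗ[k] X.obj (op F) :=
  desc fun α => average X φ α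

/-- The list collects the sources `W'` of the finitely many generating relations that make up `r`.
-/
theorem averageMap_eq_zero [CharZero k] {r : Pre X H} (hr : r ∈ rel X H) :
    ∃ s : List U.FullSubcategory, ∀ F, IsGood s F → ∀ φ : F ⟶ H, averageMap X φ r = 0 := by
  induction hr using Submodule.span_induction with
  | mem r hr =>
    obtain ⟨W', W, f, α, x, rfl⟩ := hr
    refine ⟨[W'], fun F hF φ => ?_⟩
    rw [map_sub, averageMap, desc_incl, desc_incl, average_comp hF (by simp), sub_self]
  | zero => exact ⟨[], fun F _ φ => map_zero _⟩
  | add a b _ _ ha hb =>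
    obtain ⟨s, hs⟩ := ha
    obtain ⟨t, ht⟩ := hb
    refine ⟨s ++ t, fun F hF φ => ?_⟩
    rw [map_add, hs F (hF.mono (by simp)), ht F (hF.mono (by simp)), add_zero]
  | smul c a _ ha =>
    obtain ⟨s, hs⟩ := ha
    refine ⟨s, fun F hF φ => ?_⟩
    rw [map_smul, hs F hF, smul_zero]

/-- Every lift `q` of `φ` through `α` is itself a relation between `q^*x` at `φ` and `x` at `α`;
these relations are averaged. -/
theorem sub_incl_averageMap_mem [CharZero k] (b : Pre X H) :
    ∃ s : List U.FullSubcategory, ∀ F, IsGood s F → ∀ φ : F ⟶ H,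
      incl φ (averageMap X φ b) - b ∈ rel X H := by
  induction b using induction_on with
  | zero => exact ⟨[], fun F _ φ => by simp⟩
  | incl α x =>
    rename_i W
    refine ⟨[W], fun F hF φ => ?_⟩
    have := hF.nonempty_lift (W := W) (by simp) φ α
    have hc : (Fintype.card (Lift φ α) : k) ≠ 0 := Nat.cast_ne_zero.2 Fintype.card_ne_zero
    have : incl φ (averageMap X φ (incl α x)) - incl α x =
        (Fintype.card (Lift φ α) : k)⁻¹ •
          ∑ q : Lift φ α, (incl φ (X.map q.hom.op x) - incl α x) := by
      rw [averageMap, desc_incl, average_apply, map_smul, map_sum, Finset.sum_sub_distrib,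
        smul_sub, Finset.sum_const, Finset.card_univ, ← Nat.cast_smul_eq_nsmul k, smul_smul,
        inv_mul_cancel₀ hc, one_smul]
    rw [this]
    refine Submodule.smul_mem _ _ (Submodule.sum_mem _ fun q _ => Submodule.subset_span ?_)
    refine ⟨F, W, q.hom, α, x, ?_⟩
    rw [q.hom_comp]
  | add a b ha hb =>
    obtain ⟨s, hs⟩ := ha
    obtain ⟨t, ht⟩ := hb
    refine ⟨s ++ t, fun F hF φ => ?_⟩
    have := Submodule.add_mem _ (hs F (hF.mono (by simp)) φ) (ht F (hF.mono (by simp)) φ)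
    convert this using 1
    rw [map_add, map_add]
    abel

theorem averageMap_map (θ : X ⟶ Y) {F : U.FullSubcategory} (φ : F ⟶ H) (b : Pre X H) :
    averageMap Y φ (map θ b) = θ.app (op F) (averageMap X φ b) := by
  induction b using induction_on with
  | zero => simp
  | incl α x =>
    simp only [map, averageMap, desc_incl, LinearMap.comp_apply, average_apply]
    rw [map_smul, map_sum]
    congr 1
    exact Finset.sum_congr rfl fun q _ => (naturality_apply θ _ _).symm
  | add a b ha hb => simp only [map_add, ha, hb]

end Pre

/-- The colimit of `X` over the comma category of `H`. -/
abbrev Col (X : AU k U) (H : U.FullSubcategory) : Type (max 1 u) :=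
  Pre X H ⧸ Pre.rel X H

namespace Col

variable {X Y : AU k U} {H : U.FullSubcategory}

/-- The structure maps of the colimit. -/
noncomputable def ι {W : U.FullSubcategory} (α : W ⟶ H) : X.obj (op W) →ₗ[k] Col X H :=
  (Pre.rel X H).mkQ ∘ₗ Pre.incl α

theorem ι_comp {W W' : U.FullSubcategory} (f : W' ⟶ W) (α : W ⟶ H) (x : X.obj (op W)) :
    ι (f ≫ α) (X.map f.op x) = ι α x :=
  (Submodule.Quotient.eq _).2 (Submodule.subset_span ⟨W', W, f, α, x, rfl⟩)

/-- The universal property of the colimit. -/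
noncomputable def lift {V : Type*} [AddCommGroup V] [Module k V]
    (f : ∀ {W : U.FullSubcategory} (_ : W ⟶ H), X.obj (op W) →ₗ[k] V)
    (hf : ∀ (W W' : U.FullSubcategory) (g : W' ⟶ W) (α : W ⟶ H) (x : X.obj (op W)),
      f (g ≫ α) (X.map g.op x) = f α x) : Col X H →ₗ[k] V :=
  (Pre.rel X H).liftQ (Pre.desc f) (by
    rw [Pre.rel, Submodule.span_le]
    rintro _ ⟨W', W, g, α, x, rfl⟩
    simp [hf])

@[simp]
theorem lift_ι {V : Type*} [AddCommGroup V] [Module k V]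
    (f : ∀ {W : U.FullSubcategory} (_ : W ⟶ H), X.obj (op W) →ₗ[k] V)
    (hf : ∀ (W W' : U.FullSubcategory) (g : W' ⟶ W) (α : W ⟶ H) (x : X.obj (op W)),
      f (g ≫ α) (X.map g.op x) = f α x) {W : U.FullSubcategory} (α : W ⟶ H) (x : X.obj (op W)) :
    lift f hf (ι α x) = f α x :=
  Pre.desc_incl f α x

/-- Functoriality of the colimit. -/
noncomputable def map (θ : X ⟶ Y) : Col X H →ₗ[k] Col Y H :=
  lift (fun {W} α => ι α ∘ₗ (θ.app (op W)).hom) fun _ _ g α x => by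
    simp only [LinearMap.comp_apply]
    rw [← ι_comp g α]
    exact congrArg _ (naturality_apply θ g x)

theorem map_ι (θ : X ⟶ Y) {W : U.FullSubcategory} (α : W ⟶ H) (x : X.obj (op W)) :
    map θ (ι α x) = ι α (θ.app (op W) x) :=
  Pre.desc_incl (fun {W} α => ι α ∘ₗ (θ.app (op W)).hom) α x

theorem map_mk (θ : X ⟶ Y) (b : Pre X H) :
    map θ ((Pre.rel X H).mkQ b) = (Pre.rel Y H).mkQ (Pre.map θ b) := by
  induction b using Pre.induction_on with
  | zero => simp
  | incl α x =>
    rw [Pre.map, Pre.desc_incl]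
    exact map_ι θ α x
  | add a b ha hb => simp only [map_add, ha, hb]

/-- In characteristic zero, the colimit over the comma category is exact. -/
theorem map_injective [CharZero k] (hglobal : IsGlobalFamily U) (hmul : IsMultiplicative U)
    (θ : X ⟶ Y) [Mono θ] : Function.Injective (map (H := H) θ) := by
  rw [← LinearMap.ker_eq_bot, LinearMap.ker_eq_bot']
  intro c hc
  obtain ⟨b, rfl⟩ := Submodule.mkQ_surjective _ c
  rw [map_mk] at hc
  have hc : Pre.map θ b ∈ Pre.rel Y H := (Submodule.Quotient.mk_eq_zero _).1 hc
  obtain ⟨s, hs⟩ := Pre.averageMap_eq_zero hc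
  obtain ⟨t, ht⟩ := Pre.sub_incl_averageMap_mem b
  obtain ⟨F, hF⟩ := Pre.exists_isGood hglobal hmul (H :: (s ++ t))
  obtain ⟨φ⟩ := hF.exists_hom (H := H) (by simp)
  have h1 := hs F (hF.mono fun _ h => by simp [h]) φ
  have h2 := ht F (hF.mono fun _ h => by simp [h]) φ
  -- The average of `b` is killed by the injective `θ`, so it is zero; as `b` is congruent to its
  -- average, `b` is a relation.
  rw [Pre.averageMap_map] at h1
  rw [(map_eq_zero_iff _ ((mono_iff θ).1 inferInstance F)).1 h1, map_zero, zero_sub,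
    neg_mem_iff] at h2
  exact (Submodule.Quotient.mk_eq_zero _).2 h2

/-- Elements of a torsion-free object are detected in the colimit. -/
theorem ι_id_injective [CharZero k] (hglobal : IsGlobalFamily U) (hmul : IsMultiplicative U)
    (hX : IsTorsionFree X) : Function.Injective (ι (X := X) (𝟙 H)) := by
  rw [← LinearMap.ker_eq_bot, LinearMap.ker_eq_bot']
  intro x hx
  have hx : Pre.incl (𝟙 H) x ∈ Pre.rel X H := (Submodule.Quotient.mk_eq_zero _).1 hx
  obtain ⟨s, hs⟩ := Pre.averageMap_eq_zero hx
  obtain ⟨F, hF⟩ := Pre.exists_isGood hglobal hmul (H :: s)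
  obtain ⟨φ⟩ := hF.exists_hom (H := H) (by simp)
  have h := hs F (hF.mono fun _ h => by simp [h]) φ
  have := hF.nonempty_lift (W := H) (by simp) φ (𝟙 H)
  have hc : (Fintype.card (Pre.Lift φ (𝟙 H)) : k) ≠ 0 :=
    Nat.cast_ne_zero.2 Fintype.card_ne_zero
  -- All lifts of `φ` through `𝟙 H` equal `φ` in `U`, so the vanishing average is `φ^*x` itself.
  refine hX H x ⟨F, φ, ?_⟩
  rw [Pre.averageMap, Pre.desc_incl, Pre.average_apply, Finset.sum_congr rfl
    (g := fun _ => X.map φ.op x), Finset.sum_const, Finset.card_univ, ← Nat.cast_smul_eq_nsmul k,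
    smul_smul, inv_mul_cancel₀ hc, one_smul] at h
  · exact h
  · intro q _
    rw [show q.hom = φ by simpa using q.hom_comp]

end Col

end AU

/-! ### Congruences, fibre products and wide subgroups -/

namespace OutGrp

variable {U : ObjectProperty OutGrp} (hglobal : IsGlobalFamily U) (hmul : IsMultiplicative U)

/-- A subgroup of a product of two groups in `U`, as an object of `U`. -/
def subProd {T H : U.FullSubcategory} (R : Subgroup (T.obj × H.obj)) : U.FullSubcategory :=
  ⟨of R, hglobal.isSubgroupClosed (of (T.obj × H.obj)) R
    (hmul.prod_mem _ _ T.property H.property)⟩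

/-- The quotient of a group in `U` by a congruence, as an object of `U`. -/
def quot {H : U.FullSubcategory} (c : Con H.obj) : U.FullSubcategory :=
  have : Finite c.Quotient := Finite.of_surjective c.mk' c.mk'_surjective
  ⟨of c.Quotient, hglobal.isClosedDownwards H.obj (of c.Quotient) c.mk' c.mk'_surjective
    H.property⟩

/-- The quotient map by a congruence, as a homomorphism. -/
def quotHom {H : U.FullSubcategory} (c : Con H.obj) : H.obj →* (quot hglobal c).obj :=
  c.mk'

theorem quotHom_surjective {H : U.FullSubcategory} (c : Con H.obj) :
    Function.Surjective (quotHom hglobal c) :=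
  c.mk'_surjective

theorem quotHom_eq_iff {H : U.FullSubcategory} (c : Con H.obj) {x y : H.obj} :
    quotHom hglobal c x = quotHom hglobal c y ↔ c x y :=
  Con.eq c

instance (H : OutGrp) : Finite (Con H) :=
  Finite.of_injective (fun c : Con H => (c : H → H → Prop)) DFunLike.coe_injective

noncomputable instance (H : OutGrp) : Fintype (Con H) :=
  Fintype.ofFinite _

theorem card_quot_lt {H : U.FullSubcategory} {c : Con H.obj} (hc : c ≠ ⊥) :
    Nat.card (quot hglobal c).obj < Nat.card H.obj := by
  refine lt_of_le_of_ne (Nat.card_le_card_of_surjective _ (quotHom_surjective hglobal c))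
    fun h => hc ?_
  have hinj := ((Nat.bijective_iff_surjective_and_card _).2
    ⟨quotHom_surjective hglobal c, h.symm⟩).1
  ext x y
  rw [← quotHom_eq_iff hglobal c, hinj.eq_iff]
  rfl

/-- A surjection whose kernel contains that of `π` factors through `π`. -/
theorem exists_comp_eq {T' T H : U.FullSubcategory} {π : T'.obj →* T.obj}
    (hπ : Function.Surjective π) {a : T'.obj →* H.obj} (ha : Function.Surjective a)
    (h : ∀ t, π t = 1 → a t = 1) : ∃ b : T ⟶ H, homOf π hπ ≫ b = homOf a ha := by
  have hb : (π.liftOfSurjective hπ ⟨a, fun t ht => h t ht⟩).comp π = a :=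
    π.liftOfRightInverse_comp _ (Function.rightInverse_surjInv hπ) ⟨a, fun t ht => h t ht⟩
  have hs : Function.Surjective (π.liftOfSurjective hπ ⟨a, fun t ht => h t ht⟩) := by
    refine Function.Surjective.of_comp (g := π) ?_
    rw [← MonoidHom.coe_comp, hb]
    exact ha
  refine ⟨homOf _ hs, ?_⟩
  rw [homOf_comp]
  congr

/-- The fibre product of two homomorphisms. -/
abbrev fib {T H Q : Type*} [Group T] [Group H] [Group Q] (β : T →* Q) (q : H →* Q) :
    Subgroup (T × H) :=
  (β.comp (MonoidHom.fst T H)).eqLocus (q.comp (MonoidHom.snd T H))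

section Wide

variable {T H T' : Type*} [Group T] [Group H] [Group T']

/-- The first projection of a subgroup of a product. -/
abbrev fstHom (R : Subgroup (T × H)) : R →* T :=
  (MonoidHom.fst T H).comp R.subtype

/-- The second projection of a subgroup of a product. -/
abbrev sndHom (R : Subgroup (T × H)) : R →* H :=
  (MonoidHom.snd T H).comp R.subtype

/-- A subgroup of a product is wide if both projections are surjective. -/
structure IsWide (R : Subgroup (T × H)) : Prop where
  fst_surjective : Function.Surjective (fstHom R)
  snd_surjective : Function.Surjective (sndHom R)

theorem isWide_fib {Q : Type*} [Group Q] {β : T →* Q} {q : H →* Q}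
    (hβ : Function.Surjective β) (hq : Function.Surjective q) : IsWide (fib β q) where
  fst_surjective t := by
    obtain ⟨h, hh⟩ := hq (β t)
    exact ⟨⟨(t, h), hh.symm⟩, rfl⟩
  snd_surjective h := by
    obtain ⟨t, ht⟩ := hβ (q h)
    exact ⟨⟨(t, h), ht⟩, rfl⟩

/-- The image of a subgroup of `T' × H` in `T × H`. -/
abbrev image (π : T' →* T) (R : Subgroup (T' × H)) : Subgroup (T × H) :=
  R.map (π.prodMap (MonoidHom.id H))

theorem IsWide.image {π : T' →* T} (hπ : Function.Surjective π) {R : Subgroup (T' × H)}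
    (hR : IsWide R) : IsWide (image π R) where
  fst_surjective t := by
    obtain ⟨t', rfl⟩ := hπ t
    obtain ⟨r, rfl⟩ := hR.fst_surjective t'
    exact ⟨⟨_, Subgroup.mem_map_of_mem _ r.2⟩, rfl⟩
  snd_surjective h := by
    obtain ⟨r, rfl⟩ := hR.snd_surjective h
    exact ⟨⟨_, Subgroup.mem_map_of_mem _ r.2⟩, rfl⟩

end Wide

end OutGrp

/-! ### Transfers and Möbius coefficients -/

namespace AU

open OutGrp

variable {k : Type u} [Field k] {U : ObjectProperty OutGrp}
  (hglobal : IsGlobalFamily U) (hmul : IsMultiplicative U) {X Y : AU k U}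

/-- The map `X(T) → Col X H` given by pulling back to a wide subgroup of `T × H`. -/
noncomputable def corr {T H : U.FullSubcategory} {R : Subgroup (T.obj × H.obj)} (hR : IsWide R) :
    X.obj (op T) →ₗ[k] Col X H :=
  Col.ι (homOf (G := subProd hglobal hmul R) (sndHom R) hR.snd_surjective) ∘ₗ
    (X.map (homOf (G := subProd hglobal hmul R) (fstHom R) hR.fst_surjective).op).hom

theorem corr_congr {T H : U.FullSubcategory} {R R' : Subgroup (T.obj × H.obj)} (hR : IsWide R)
    (hR' : IsWide R') (h : R = R') (x : X.obj (op T)) :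
    corr hglobal hmul hR x = corr hglobal hmul hR' x := by
  subst h
  rfl

theorem corr_map {T T' H : U.FullSubcategory} {R : Subgroup (T.obj × H.obj)}
    {R' : Subgroup (T'.obj × H.obj)} (hR : IsWide R) (hR' : IsWide R') {π : T'.obj →* T.obj}
    (hπ : Function.Surjective π) (f : R' →* R) (hf : Function.Surjective f) (g : H.obj)
    (h₁ : ∀ r, fstHom R (f r) = π (fstHom R' r))
    (h₂ : ∀ r, sndHom R (f r) = g * sndHom R' r * g⁻¹) (x : X.obj (op T)) :
    corr hglobal hmul hR' (X.map (homOf π hπ).op x) = corr hglobal hmul hR x := by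
  let F : subProd hglobal hmul R' ⟶ subProd hglobal hmul R :=
    homOf (G := subProd hglobal hmul R') (H := subProd hglobal hmul R) f hf
  have e₁ : F ≫ homOf (G := subProd hglobal hmul R) (fstHom R) hR.fst_surjective =
      homOf (G := subProd hglobal hmul R') (fstHom R') hR'.fst_surjective ≫ homOf π hπ := by
    refine homOf_eq_iff.2 ⟨1, fun r => ?_⟩
    exact (h₁ r).symm.trans (show fstHom R (f r) = 1 * fstHom R (f r) * 1⁻¹ by simp)
  have e₂ : F ≫ homOf (G := subProd hglobal hmul R) (sndHom R) hR.snd_surjective =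
      homOf (G := subProd hglobal hmul R') (sndHom R') hR'.snd_surjective := by
    refine (homOf_eq_iff.2 ⟨g, fun r => ?_⟩).symm
    exact h₂ r
  simp only [corr, LinearMap.comp_apply]
  rw [← Col.ι_comp F, ← map_comp_apply, ← map_comp_apply, e₁, e₂]

theorem corr_image {T T' H : U.FullSubcategory} {R' : Subgroup (T'.obj × H.obj)}
    (hR' : IsWide R') {π : T'.obj →* T.obj} (hπ : Function.Surjective π) (x : X.obj (op T)) :
    corr hglobal hmul hR' (X.map (homOf π hπ).op x) = corr hglobal hmul (hR'.image hπ) x := by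
  refine corr_map hglobal hmul _ _ hπ
    ((π.prodMap (MonoidHom.id H.obj)).subgroupMap R')
    (MonoidHom.subgroupMap_surjective _ _) 1 (fun r => rfl) (fun r => ?_) x
  simp only [one_mul, inv_one, mul_one]
  rfl

/-- Makes `transfer` well defined. The representatives agree only up to an element of `Q`; a
preimage `g` of it in `H` twists the second coordinate to compensate. -/
theorem corr_fib {T T' H Q : U.FullSubcategory} {q : H.obj →* Q.obj}
    (hq : Function.Surjective q) {β : T.obj →* Q.obj} (hβ : Function.Surjective β)
    {β' : T'.obj →* Q.obj} (hβ' : Function.Surjective β') {π : T'.obj →* T.obj}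
    (hπ : Function.Surjective π) (x : X.obj (op T))
    (h : homOf β' hβ' = homOf π hπ ≫ homOf β hβ) :
    corr hglobal hmul (isWide_fib hβ' hq) (X.map (homOf π hπ).op x) =
      corr hglobal hmul (isWide_fib hβ hq) x := by
  rw [homOf_comp, homOf_eq_iff] at h
  obtain ⟨l, hl⟩ := h
  obtain ⟨g, rfl⟩ := hq l
  let f₀ : T'.obj × H.obj →* T.obj × H.obj := π.prodMap (MulAut.conj g).toMonoidHom
  refine corr_map hglobal hmul _ _ hπ
    ((f₀.comp (fib β' q).subtype).codRestrict (fib β q) ?_) ?_ g (fun r => rfl) (fun r => rfl) x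
  · rintro ⟨⟨t, y⟩, hty⟩
    have hty : β' t = q y := hty
    change β (π t) = q (g * y * g⁻¹)
    rw [map_mul, map_mul, map_inv, ← hty]
    exact hl t
  · rintro ⟨⟨t, y⟩, hty⟩
    have hty : β t = q y := hty
    obtain ⟨t, rfl⟩ := hπ t
    have hlt : β (π t) = q g * β' t * (q g)⁻¹ := hl t
    refine ⟨⟨(t, g⁻¹ * y * g), ?_⟩, Subtype.ext (Prod.ext rfl ?_)⟩
    · change β' t = q (g⁻¹ * y * g)
      rw [map_mul, map_mul, map_inv, ← hty, hlt]
      group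
    · change g * (g⁻¹ * y * g) * g⁻¹ = y
      group

/-- The transfer along a surjection `q : H → Q`, given by pulling back along `q`. -/
noncomputable def transfer {H Q : U.FullSubcategory} {q : H.obj →* Q.obj}
    (hq : Function.Surjective q) : Col X Q →ₗ[k] Col X H :=
  Col.lift (fun {_} β => corr hglobal hmul
    (isWide_fib (exists_homOf_eq β).choose_spec.choose hq)) (by
    intro W W' g α x
    obtain ⟨π, hπ, rfl⟩ := exists_homOf_eq g
    refine corr_fib hglobal hmul hq (exists_homOf_eq α).choose_spec.choose
      (exists_homOf_eq (homOf π hπ ≫ α)).choose_spec.choose hπ x ?_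
    rw [(exists_homOf_eq (homOf π hπ ≫ α)).choose_spec.choose_spec,
      (exists_homOf_eq α).choose_spec.choose_spec])

theorem transfer_ι {H Q : U.FullSubcategory} {q : H.obj →* Q.obj}
    (hq : Function.Surjective q) {T : U.FullSubcategory} {β : T.obj →* Q.obj}
    (hβ : Function.Surjective β) (x : X.obj (op T)) :
    transfer hglobal hmul hq (Col.ι (homOf β hβ) x) =
      corr hglobal hmul (isWide_fib hβ hq) x := by
  rw [transfer, Col.lift_ι]
  have := corr_fib hglobal hmul hq hβ (exists_homOf_eq (homOf β hβ)).choose_spec.choose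
    (π := MonoidHom.id T.obj) Function.surjective_id x (by
      rw [(exists_homOf_eq (homOf β hβ)).choose_spec.choose_spec, homOf_id, Category.id_comp])
  rw [homOf_id, map_id_apply] at this
  exact this

theorem transfer_map (θ : X ⟶ Y) {H Q : U.FullSubcategory} {q : H.obj →* Q.obj}
    (hq : Function.Surjective q) {T : U.FullSubcategory} (β : T ⟶ Q) (x : X.obj (op T)) :
    Col.map θ (transfer hglobal hmul hq (Col.ι β x)) =
      transfer hglobal hmul hq (Col.ι β (θ.app (op T) x)) := by
  obtain ⟨β, hβ, rfl⟩ := exists_homOf_eq β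
  rw [transfer_ι, transfer_ι]
  simp only [corr, LinearMap.comp_apply]
  rw [Col.map_ι]
  exact congrArg _ (naturality_apply θ _ x)

variable (k) in
/-- The Möbius function of the lattice of congruences. -/
noncomputable def moebius (H : OutGrp) : Con H → k :=
  (exists_moebius k (Con H)).choose

theorem moebius_bot (H : OutGrp) : moebius k H ⊥ = 1 :=
  (exists_moebius k (Con H)).choose_spec.1

/-- The component at `a : T ⟶ H` of the map from `X` to `e_H ⊗ Col X H`. -/
noncomputable def coeff {T H : U.FullSubcategory} (a : T ⟶ H) : X.obj (op T) →ₗ[k] Col X H :=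
  ∑ c : Con H.obj, moebius k H.obj c •
    (transfer hglobal hmul (quotHom_surjective hglobal c) ∘ₗ
      Col.ι (a ≫ homOf (quotHom hglobal c) (quotHom_surjective hglobal c)))

theorem coeff_apply {T H : U.FullSubcategory} (a : T ⟶ H) (x : X.obj (op T)) :
    coeff hglobal hmul a x = ∑ c : Con H.obj, moebius k H.obj c •
      transfer hglobal hmul (quotHom_surjective hglobal c)
        (Col.ι (a ≫ homOf (quotHom hglobal c) (quotHom_surjective hglobal c)) x) := by
  simp [coeff]

theorem coeff_comp {T T' H : U.FullSubcategory} (π : T' ⟶ T) (b : T ⟶ H) (x : X.obj (op T)) :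
    coeff hglobal hmul (π ≫ b) (X.map π.op x) = coeff hglobal hmul b x := by
  rw [coeff_apply, coeff_apply]
  refine Finset.sum_congr rfl fun c _ => ?_
  rw [Category.assoc, Col.ι_comp]

theorem coeff_map (θ : X ⟶ Y) {T H : U.FullSubcategory} (a : T ⟶ H) (x : X.obj (op T)) :
    Col.map θ (coeff hglobal hmul a x) = coeff hglobal hmul a (θ.app (op T) x) := by
  rw [coeff_apply, coeff_apply, map_sum]
  refine Finset.sum_congr rfl fun c _ => ?_
  rw [map_smul, transfer_map]

/-- The image of the fibre product of `a` over a congruence only depends on the join of the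
congruence with the image of the kernel of `π`. -/
theorem image_fib_sup {T T' H : U.FullSubcategory} {π : T'.obj →* T.obj} {a : T'.obj →* H.obj}
    (c : Con H.obj) [hn : (π.ker.map a).Normal] :
    image π (fib ((quotHom hglobal c).comp a) (quotHom hglobal c)) =
      image π (fib ((quotHom hglobal (c ⊔ QuotientGroup.con (π.ker.map a))).comp a)
        (quotHom hglobal (c ⊔ QuotientGroup.con (π.ker.map a)))) := by
  set K := π.ker.map a
  refine le_antisymm (Subgroup.map_mono fun r hr => ?_) ?_
  · exact (quotHom_eq_iff _ _).2
      ((le_sup_left : c ≤ c ⊔ QuotientGroup.con K) ((quotHom_eq_iff _ _).1 hr))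
  · rintro _ ⟨⟨t, h⟩, hr, rfl⟩
    have hr : (c ⊔ QuotientGroup.con K) (a t) h := (quotHom_eq_iff _ _).1 hr
    have : (K.map c.mk').Normal := hn.map _ c.mk'_surjective
    -- Modulo `c`, elements related by the join differ by some `a s` with `s` in the kernel of `π`;
    -- replacing `t` by `t * s` does not change the image under `π`.
    have hle : c ⊔ QuotientGroup.con K ≤
        Con.ker ((QuotientGroup.mk' (K.map c.mk')).comp c.mk') := by
      refine sup_le (fun x y hxy => ?_) (fun x y hxy => ?_)
      · rw [Con.ker_rel]
        exact congrArg (QuotientGroup.mk' (K.map c.mk')) ((Con.eq c).2 hxy)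
      · have hxy : x⁻¹ * y ∈ K := QuotientGroup.leftRel_apply.1 hxy
        rw [Con.ker_rel]
        refine QuotientGroup.eq.2 ?_
        rw [← map_inv, ← map_mul]
        exact Subgroup.mem_map_of_mem _ hxy
    have h2 := Con.ker_rel _ |>.1 (hle hr)
    obtain ⟨_, ⟨s, hs, rfl⟩, h3⟩ := QuotientGroup.eq.1 h2
    have hs : π s = 1 := hs
    have h4 : c.mk' (a (t * s)) = c.mk' h := by
      rw [map_mul, map_mul, h3]
      group
    refine ⟨(t * s, h), h4, Prod.ext ?_ rfl⟩
    simp [hs]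

/-- The congruence `d` of `a(ker π)` is not `⊥`, since otherwise `a` would factor through `π`. The
term of `c` only depends on `c ⊔ d`, so Weisner's theorem applies. -/
theorem coeff_eq_zero {T T' H : U.FullSubcategory} (π : T' ⟶ T) (a : T' ⟶ H)
    (h : ¬∃ b : T ⟶ H, π ≫ b = a) (x : X.obj (op T)) :
    coeff hglobal hmul a (X.map π.op x) = 0 := by
  obtain ⟨π, hπ, rfl⟩ := exists_homOf_eq π
  obtain ⟨a, ha, rfl⟩ := exists_homOf_eq a
  have hn : (π.ker.map a).Normal := π.normal_ker.map a ha
  have hd : QuotientGroup.con (π.ker.map a) ≠ ⊥ := by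
    refine fun hd => h (exists_comp_eq hπ ha fun t ht => ?_)
    have : QuotientGroup.con (π.ker.map a) 1 (a t) := QuotientGroup.leftRel_apply.2 (by
      rw [inv_one, one_mul]
      exact ⟨t, ht, rfl⟩)
    rw [hd] at this
    exact this.symm
  rw [coeff_apply]
  refine sum_moebius_smul_eq_zero (exists_moebius k (Con H.obj)).choose_spec.2 hd _ fun c => ?_
  rw [homOf_comp, homOf_comp, transfer_ι, transfer_ι, corr_image, corr_image]
  exact corr_congr _ _ _ _ (image_fib_sup hglobal c) x

/-- The fibre product over the quotient by `⊥` is the graph of `a`, so its second projection is the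
first followed by `a`. -/
theorem transfer_bot {T H : U.FullSubcategory} (a : T ⟶ H) (x : X.obj (op T)) :
    transfer hglobal hmul (quotHom_surjective hglobal (⊥ : Con H.obj))
      (Col.ι (a ≫ homOf (quotHom hglobal ⊥) (quotHom_surjective hglobal ⊥)) x) =
      Col.ι a x := by
  obtain ⟨a, ha, rfl⟩ := exists_homOf_eq a
  rw [homOf_comp, transfer_ι]
  simp only [corr, LinearMap.comp_apply]
  set R := fib ((quotHom hglobal ⊥).comp a) (quotHom hglobal ⊥)
  have hR : IsWide R := isWide_fib ((quotHom_surjective hglobal ⊥).comp ha)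
    (quotHom_surjective hglobal ⊥)
  have e : homOf (G := subProd hglobal hmul R) (fstHom R) hR.fst_surjective ≫ homOf a ha =
      homOf (G := subProd hglobal hmul R) (sndHom R) hR.snd_surjective := by
    refine homOf_eq_iff.2 ⟨1, fun r => ?_⟩
    have h : a (fstHom R r) = sndHom R r := (quotHom_eq_iff hglobal ⊥).1 r.2
    exact h.symm.trans (show a (fstHom R r) = 1 * a (fstHom R r) * 1⁻¹ by simp)
  rw [← Col.ι_comp (homOf (G := subProd hglobal hmul R) (fstHom R) hR.fst_surjective)
    (homOf a ha) x, e]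

/-- If the other terms vanish, the coefficient is the class in the colimit. -/
theorem coeff_eq_of_forall {V : Type*} [AddCommGroup V] [Module k V] {T H : U.FullSubcategory}
    (L : Col X H →ₗ[k] V) (a : T ⟶ H) (x : X.obj (op T))
    (h : ∀ c : Con H.obj, c ≠ ⊥ → L (transfer hglobal hmul (quotHom_surjective hglobal c)
      (Col.ι (a ≫ homOf (quotHom hglobal c) (quotHom_surjective hglobal c)) x)) = 0) :
    L (coeff hglobal hmul a x) = L (Col.ι a x) := by
  rw [coeff_apply, map_sum, Finset.sum_eq_single ⊥, map_smul, moebius_bot, one_smul, transfer_bot]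
  · intro c _ hc
    rw [map_smul, h c hc, smul_zero]
  · simp

end AU

/-! ### A skeleton of `U` -/

namespace OutGrp

/-- A small set of representatives of the isomorphism classes of objects of `U`. -/
def Skel (U : ObjectProperty OutGrp) : Type :=
  {p : Σ n : ℕ, Group (Fin n) // U (@OutGrp.mk (Fin p.1) p.2 inferInstance)}

variable {U : ObjectProperty OutGrp}

/-- The object of `U` given by a representative. -/
def Skel.obj (S : Skel U) : U.FullSubcategory :=
  ⟨@OutGrp.mk (Fin S.1.1) S.1.2 inferInstance, S.2⟩

theorem exists_skel (hglobal : IsGlobalFamily U) (G : U.FullSubcategory) :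
    ∃ S : Skel U, Nonempty (S.obj.obj ≃* G.obj) := by
  obtain ⟨n, ⟨e⟩⟩ := Finite.exists_equiv_fin G.obj
  let g : Group (Fin n) := e.symm.group
  let f : @MulEquiv (Fin n) G.obj g.toMul _ :=
    @MulEquiv.mk (Fin n) G.obj g.toMul _ e.symm
      fun x y => e.symm_apply_apply (e.symm x * e.symm y)
  exact ⟨⟨⟨n, g⟩, hglobal.isClosedDownwards.of_mulEquiv
    (@MulEquiv.symm (Fin n) G.obj g.toMul _ f) G.property⟩, ⟨f⟩⟩

theorem Skel.finite_le (U : ObjectProperty OutGrp) (N : ℕ) :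
    Finite {S : Skel U // Nat.card S.obj.obj ≤ N} := by
  have hg : ∀ n, Finite (Group (Fin n)) := fun n =>
    Finite.of_injective (fun g : Group (Fin n) => g.mul) fun g g' h => Group.ext h
  refine Finite.of_injective (β := Σ n : Fin (N + 1), Group (Fin n))
    (fun S => ⟨⟨S.1.1.1, Nat.lt_succ_of_le (by simpa [Skel.obj] using S.2)⟩, S.1.1.2⟩) ?_
  rintro ⟨⟨⟨n, g⟩, h⟩, hn⟩ ⟨⟨⟨n', g'⟩, h'⟩, hn'⟩ heq
  simp only [Sigma.mk.injEq, Fin.mk.injEq] at heq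
  obtain ⟨rfl, heq⟩ := heq
  obtain rfl := eq_of_heq heq
  rfl

/-- Quotients of `T` have bounded order. Finiteness lets an arbitrary family of coefficients define
an element of the direct sum in `free.lift`. -/
instance (T : U.FullSubcategory) : Finite (Σ S : Skel U, (T ⟶ S.obj)) := by
  have := Skel.finite_le U (Nat.card T.obj)
  refine Finite.of_injective
    (β := Σ S : {S : Skel U // Nat.card S.obj.obj ≤ Nat.card T.obj}, (T ⟶ S.1.obj))
    (fun p => ⟨⟨p.1, ?_⟩, p.2⟩) ?_
  · obtain ⟨φ, hφ, -⟩ := exists_homOf_eq p.2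
    exact Nat.card_le_card_of_surjective φ hφ
  · rintro ⟨S, a⟩ ⟨S', a'⟩ h
    simp only [Sigma.mk.injEq, Subtype.mk.injEq] at h
    obtain ⟨rfl, h⟩ := h
    obtain rfl := eq_of_heq h
    rfl

end OutGrp

/-! ### Free objects: projectivity and injectivity -/

namespace AU

open OutGrp

variable {k : Type u} [Field k] {U : ObjectProperty OutGrp}

/-- The functions inducing the functoriality of `⨁ e_S ⊗ V`. -/
abbrev precomp {T' T : U.FullSubcategory} (f : T' ⟶ T) (p : Σ S : Skel U, (T ⟶ S.obj)) :
    Σ S : Skel U, (T' ⟶ S.obj) :=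
  ⟨p.1, f ≫ p.2⟩

theorem precomp_injective {T' T : U.FullSubcategory} (f : T' ⟶ T) :
    Function.Injective (precomp f) := by
  rintro ⟨S, a⟩ ⟨S', a'⟩ h
  simp only [precomp, Sigma.mk.injEq] at h
  obtain ⟨rfl, h⟩ := h
  rw [(cancel_epi f).1 (eq_of_heq h)]

variable (k U) in
/-- The direct sum of all `e_S ⊗ V`, for `S` in a skeleton of `U`. -/
noncomputable def free (V : Type u) [AddCommGroup V] [Module k V] : AU k U where
  obj T := ModuleCat.of k ((Σ S : Skel U, (unop T ⟶ S.obj)) →₀ V)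
  map f := ModuleCat.ofHom (Finsupp.lmapDomain V k (precomp f.unop))
  map_id T := by
    have h : precomp (𝟙 (unop T)) = id := funext fun p => by simp [precomp]
    rw [unop_id, h]
    exact ModuleCat.hom_ext (Finsupp.lmapDomain_id V k)
  map_comp f g := by
    have h : precomp (g.unop ≫ f.unop) = precomp g.unop ∘ precomp f.unop :=
      funext fun p => by simp [precomp]
    rw [unop_comp, h]
    exact ModuleCat.hom_ext (Finsupp.lmapDomain_comp V k (precomp f.unop) (precomp g.unop))

section free

variable {V : Type u} [AddCommGroup V] [Module k V]

/-- Elements of `free k U V`, as finitely supported functions. -/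
noncomputable def free.val {T : U.FullSubcategory} :
    (free k U V).obj (op T) →ₗ[k] ((Σ S : Skel U, (T ⟶ S.obj)) →₀ V) :=
  LinearMap.id

theorem free.val_injective {T : U.FullSubcategory} :
    Function.Injective (free.val (k := k) (V := V) (T := T)) :=
  fun _ _ h => h

theorem free.val_map {T T' : U.FullSubcategory} (f : T' ⟶ T) (x : (free k U V).obj (op T)) :
    free.val ((free k U V).map f.op x) = Finsupp.mapDomain (precomp f) (free.val x) :=
  rfl

theorem free.val_map_apply {T T' : U.FullSubcategory} (f : T' ⟶ T) {S : Skel U}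
    (a : T ⟶ S.obj) (x : (free k U V).obj (op T)) :
    free.val ((free k U V).map f.op x) ⟨S, f ≫ a⟩ = free.val x ⟨S, a⟩ := by
  rw [free.val_map]
  exact Finsupp.mapDomain_apply (precomp_injective f) _ (⟨S, a⟩ : Σ S : Skel U, (T ⟶ S.obj))

theorem free.val_map_apply_eq_zero {T T' : U.FullSubcategory} (f : T' ⟶ T) {S : Skel U}
    (a : T' ⟶ S.obj) (h : ¬∃ b, f ≫ b = a) (x : (free k U V).obj (op T)) :
    free.val ((free k U V).map f.op x) ⟨S, a⟩ = 0 := by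
  rw [free.val_map]
  refine Finsupp.mapDomain_of_notMem_range _ _ fun ⟨⟨S', b⟩, hb⟩ => h ?_
  simp only [precomp, Sigma.mk.injEq] at hb
  obtain ⟨rfl, hb⟩ := hb
  exact ⟨b, eq_of_heq hb⟩

theorem free_isTorsionFree : IsTorsionFree (free k U V) := by
  rintro G x ⟨H, f, hf⟩
  refine free.val_injective (Finsupp.mapDomain_injective (precomp_injective f) ?_)
  rw [← free.val_map, hf, map_zero, map_zero, Finsupp.mapDomain_zero]

/-- Maps out of `free k U V` are given by linear maps on `V`. -/
noncomputable def free.desc {A : AU k U} (g : ∀ S : Skel U, V →ₗ[k] A.obj (op S.obj)) :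
    free k U V ⟶ A where
  app T := ModuleCat.ofHom (Finsupp.lsum k fun p : Σ S : Skel U, (unop T ⟶ S.obj) =>
    (A.map p.2.op).hom ∘ₗ g p.1)
  naturality T T' f := by
    ext : 1
    refine Finsupp.lhom_ext fun p v => ?_
    change Finsupp.lsum k _ (Finsupp.mapDomain (precomp f.unop) (Finsupp.single p v)) =
      A.map f (Finsupp.lsum k _ (Finsupp.single p v))
    rw [Finsupp.mapDomain_single, Finsupp.lsum_single, Finsupp.lsum_single]
    exact map_comp_apply A f.unop p.2 (g p.1 v)

/-- The generators of `free k U V`. -/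
noncomputable def free.gen (S : Skel U) : V →ₗ[k] (free k U V).obj (op S.obj) :=
  Finsupp.lsingle (⟨S, 𝟙 _⟩ : Σ S' : Skel U, (S.obj ⟶ S'.obj))

theorem free.desc_app_map_gen {A : AU k U} (g : ∀ S : Skel U, V →ₗ[k] A.obj (op S.obj))
    {T : U.FullSubcategory} {S : Skel U} (a : T ⟶ S.obj) (v : V) :
    (free.desc g).app (op T) ((free k U V).map a.op (free.gen S v)) = A.map a.op (g S v) := by
  rw [naturality_apply]
  congr 1
  change Finsupp.lsum k _ (Finsupp.single _ v) = _
  rw [Finsupp.lsum_single]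
  exact map_id_apply A (g S v)

theorem free.hom_ext {A : AU k U} {f g : free k U V ⟶ A}
    (h : ∀ S v, f.app (op (Skel.obj S)) (free.gen S v) = g.app (op S.obj) (free.gen S v)) :
    f = g := by
  ext T : 3
  refine Finsupp.lhom_ext fun p v => ?_
  have hp : (Finsupp.single p v : (Σ S : Skel U, (unop T ⟶ S.obj)) →₀ V) =
      (free k U V).map p.2.op (free.gen p.1 v) := by
    refine Eq.trans ?_ (Finsupp.mapDomain_single (f := precomp p.2)).symm
    simp [precomp]
  have := (naturality_apply f p.2 (free.gen p.1 v)).trans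
    ((congrArg _ (h p.1 v)).trans (naturality_apply g p.2 (free.gen p.1 v)).symm)
  rw [← hp] at this
  exact this

theorem free_projective : Projective (free k U V) where
  factors {B A} f e _ := by
    have he := (epi_iff e).1 inferInstance
    have : ∀ S : Skel U, ∃ g : V →ₗ[k] B.obj (op S.obj),
        (e.app (op S.obj)).hom ∘ₗ g = (f.app (op S.obj)).hom ∘ₗ free.gen S := fun S =>
      Module.projective_lifting_property _ _ (he S.obj)
    choose g hg using this
    refine ⟨free.desc g, free.hom_ext fun S v => ?_⟩
    have h1 := free.desc_app_map_gen g (𝟙 S.obj) v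
    rw [map_id_apply, map_id_apply] at h1
    refine (congrArg (e.app (op S.obj)) h1).trans ?_
    exact LinearMap.congr_fun (hg S) v

variable (hglobal : IsGlobalFamily U) (hmul : IsMultiplicative U)

/-- The map to `free k U V` with prescribed coefficients. -/
noncomputable def free.lift {X : AU k U} (L : ∀ S : Skel U, Col X S.obj →ₗ[k] V) :
    X ⟶ free k U V where
  app T := ModuleCat.ofHom ((Finsupp.linearEquivFunOnFinite k V
    (Σ S : Skel U, (unop T ⟶ S.obj))).symm.toLinearMap ∘ₗ
      LinearMap.pi fun p => L p.1 ∘ₗ coeff hglobal hmul p.2)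
  naturality T T' f := by
    ext x
    refine free.val_injective (Finsupp.ext ?_)
    rintro ⟨S, a⟩
    -- Pullback along `f` moves the coefficient at `b` to `f ≫ b` and is zero elsewhere, matching
    -- `coeff_comp` and `coeff_eq_zero`.
    by_cases h : ∃ b, f.unop ≫ b = a
    · obtain ⟨b, rfl⟩ := h
      refine Eq.trans ?_ (free.val_map_apply f.unop b _).symm
      exact congrArg (L S) (coeff_comp hglobal hmul f.unop b x)
    · refine Eq.trans ?_ (free.val_map_apply_eq_zero f.unop a h _).symm
      exact (congrArg (L S) (coeff_eq_zero hglobal hmul f.unop a h x)).trans (map_zero _)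

theorem free.val_lift {X : AU k U} (L : ∀ S : Skel U, Col X S.obj →ₗ[k] V)
    {T : U.FullSubcategory} (x : X.obj (op T)) {S : Skel U} (a : T ⟶ S.obj) :
    free.val ((free.lift hglobal hmul L).app (op T) x) ⟨S, a⟩ = L S (coeff hglobal hmul a x) :=
  rfl

/-- The functionals on the colimits given by the coefficients of a map to `free k U V`. -/
noncomputable def free.coord {X : AU k U} (g : X ⟶ free k U V) (S : Skel U) :
    Col X S.obj →ₗ[k] V :=
  Col.lift (fun {W} α => Finsupp.lapply (⟨S, α⟩ : Σ S : Skel U, (W ⟶ S.obj)) ∘ₗ free.val ∘ₗ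
    (g.app (op W)).hom) fun W W' f α x => by
      change free.val (g.app (op W') (X.map f.op x)) _ = free.val (g.app (op W) x) _
      rw [naturality_apply]
      exact free.val_map_apply f α _

theorem free.coord_ι {X : AU k U} (g : X ⟶ free k U V) {S : Skel U} {T : U.FullSubcategory}
    (a : T ⟶ S.obj) (x : X.obj (op T)) :
    free.coord g S (Col.ι a x) = free.val (g.app (op T) x) ⟨S, a⟩ := by
  rw [free.coord, Col.lift_ι]
  rfl

/-- For `c ≠ ⊥`, the second projection of the fibre product over the quotient by `c` does not
factor through the first. -/
theorem not_exists_fst_comp_eq_snd {T H : U.FullSubcategory} {a : T.obj →* H.obj}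
    {c : Con H.obj} (hc : c ≠ ⊥)
    (hR : IsWide (fib ((quotHom hglobal c).comp a) (quotHom hglobal c))) :
    ¬∃ b : T ⟶ H,
      homOf (G := subProd hglobal hmul (fib ((quotHom hglobal c).comp a) (quotHom hglobal c)))
        (fstHom _) hR.fst_surjective ≫ b =
      homOf (G := subProd hglobal hmul (fib ((quotHom hglobal c).comp a) (quotHom hglobal c)))
        (sndHom _) hR.snd_surjective := by
  rintro ⟨b, hb⟩
  obtain ⟨b, hbs, rfl⟩ := exists_homOf_eq b
  obtain ⟨h, hh⟩ := homOf_eq_iff.1 (homOf_comp.symm.trans hb)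
  -- Such a `y` gives the point `(1, y)` of the fibre product, so `y` would be conjugate to `b 1 =
  -- 1`.
  have key : ∀ y, c 1 y → y = 1 := by
    intro y hy
    have hmem : ((1 : T.obj), y) ∈ fib ((quotHom hglobal c).comp a) (quotHom hglobal c) := by
      refine (quotHom_eq_iff hglobal c).2 ?_
      change c (a 1) y
      rwa [map_one]
    have h1 : y = h * b 1 * h⁻¹ := hh ⟨_, hmem⟩
    simpa using h1
  refine hc (Con.ext fun x y => ⟨fun hxy => ?_, fun hxy => ?_⟩)
  · have h1 := c.mul (c.refl x⁻¹) hxy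
    rw [inv_mul_cancel] at h1
    exact (inv_mul_eq_one.1 (key _ h1))
  · have hxy : x = y := hxy
    exact hxy ▸ c.refl x

/-- Retractions of the injections `Col.map θ` extend the functionals `free.coord g` to `Y`. The
resulting map restricts to `g`: the terms with `c ≠ ⊥` read off a pullback along the first
projection at the second projection, which does not factor through it, so only the term of `⊥`
survives. -/
theorem free_injective [CharZero k] (hglobal : IsGlobalFamily U) (hmul : IsMultiplicative U) :
     Injective (free k U V) where
  factors {X Y} g θ _ := by
    have : ∀ S : Skel U, ∃ r : Col Y S.obj →ₗ[k] Col X S.obj,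
        r ∘ₗ Col.map θ = LinearMap.id := fun S =>
      LinearMap.exists_leftInverse_of_injective _
        (LinearMap.ker_eq_bot.2 (Col.map_injective hglobal hmul θ))
    choose r hr using this
    refine ⟨free.lift hglobal hmul fun S => free.coord g S ∘ₗ r S, ?_⟩
    ext T x
    refine free.val_injective (Finsupp.ext ?_)
    rintro ⟨S, a⟩
    refine (free.val_lift hglobal hmul (fun S => free.coord g S ∘ₗ r S) (T := T.unop)
      (θ.app T x) a).trans ?_
    have h1 : r S (coeff hglobal hmul a (θ.app (op T.unop) x)) = coeff hglobal hmul a x := by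
      rw [← coeff_map]
      exact LinearMap.congr_fun (hr S) _
    refine (congrArg (free.coord g S) h1).trans ?_
    have hR : ∀ (c : Con S.obj.obj) (a : (unop T).obj →* S.obj.obj) (_ : Function.Surjective a),
        IsWide (fib ((quotHom hglobal c).comp a) (quotHom hglobal c)) := fun c a ha =>
      isWide_fib ((quotHom_surjective hglobal c).comp ha) (quotHom_surjective hglobal c)
    rw [coeff_eq_of_forall, free.coord_ι]
    intro c hc
    obtain ⟨a, ha, rfl⟩ := exists_homOf_eq a
    rw [homOf_comp, transfer_ι]
    simp only [corr, LinearMap.comp_apply]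
    rw [free.coord_ι]
    refine (congrArg (fun z => free.val z _) (naturality_apply g _ x)).trans ?_
    exact free.val_map_apply_eq_zero
      (homOf (G := subProd hglobal hmul (fib ((quotHom hglobal c).comp a) (quotHom hglobal c)))
        (fstHom _) (hR c a ha).fst_surjective)
      (homOf (G := subProd hglobal hmul (fib ((quotHom hglobal c).comp a) (quotHom hglobal c)))
        (sndHom _) (hR c a ha).snd_surjective)
      (not_exists_fst_comp_eq_snd hglobal hmul hc (hR c a ha)) _

end free

/-! ### Embeddings into free objects and the equivalence -/

/-- Composition with a morphism `H ⟶ H'`. -/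
noncomputable def Col.post {X : AU k U} {H H' : U.FullSubcategory} (f : H ⟶ H') :
    Col X H →ₗ[k] Col X H' :=
  Col.lift (fun {_} α => Col.ι (α ≫ f)) fun _ _ g α x => by rw [Category.assoc, Col.ι_comp]

theorem Col.post_ι {X : AU k U} {H H' T : U.FullSubcategory} (f : H ⟶ H') (α : T ⟶ H)
    (x : X.obj (op T)) : Col.post f (Col.ι α x) = Col.ι (α ≫ f) x := by
  rw [Col.post, Col.lift_ι]

variable (hglobal : IsGlobalFamily U) (hmul : IsMultiplicative U)

/-- Take `a : T ⟶ H` with `Col.ι a x ≠ 0` and `H` of least order. The terms with `c ≠ ⊥` pass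
through smaller quotients and vanish, so the coefficient equals `Col.ι a x`. -/
theorem exists_coeff_ne_zero [CharZero k] {X : AU k U} (hX : IsTorsionFree X)
    {T : U.FullSubcategory} {x : X.obj (op T)} (hx : x ≠ 0) :
    ∃ (S : Skel U) (a : T ⟶ S.obj), coeff hglobal hmul a x ≠ 0 := by
  classical
  have hex : ∃ n, ∃ (H : U.FullSubcategory) (a : T ⟶ H), Nat.card H.obj = n ∧ Col.ι a x ≠ 0 :=
    ⟨_, T, 𝟙 T, rfl, fun h => hx (Col.ι_id_injective hglobal hmul hX (h.trans (map_zero _).symm))⟩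
  obtain ⟨H, a, hH, ha⟩ := Nat.find_spec hex
  obtain ⟨S, ⟨f⟩⟩ := exists_skel hglobal H
  let i : S.obj ≅ H := isoOf f
  have hS : Nat.card S.obj.obj = Nat.find hex := (Nat.card_congr f.toEquiv).trans hH
  have ha' : Col.ι (a ≫ i.inv) x ≠ 0 := by
    intro h
    have := Col.post_ι i.hom (a ≫ i.inv) x
    rw [h, map_zero, Category.assoc, i.inv_hom_id, Category.comp_id] at this
    exact ha this.symm
  refine ⟨S, a ≫ i.inv, ?_⟩
  have := coeff_eq_of_forall hglobal hmul LinearMap.id (a ≫ i.inv) x fun c hc => by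
    have hz : Col.ι ((a ≫ i.inv) ≫ homOf (quotHom hglobal c) (quotHom_surjective hglobal c)) x
        = 0 := by
      by_contra hne
      exact Nat.find_min hex (hS ▸ card_quot_lt hglobal hc) ⟨_, _, rfl, hne⟩
    rw [hz, map_zero, map_zero]
  rw [LinearMap.id_apply, LinearMap.id_apply] at this
  rwa [this]

/-- In characteristic zero, torsion-free objects embed in a free object. -/
theorem exists_mono_free [CharZero k] (hglobal : IsGlobalFamily U) (hmul : IsMultiplicative U)
    {X : AU k U} (hX : IsTorsionFree X) :
    ∃ (V : Type u) (_ : AddCommGroup V) (_ : Module k V) (f : X ⟶ free k U V), Mono f := by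
  classical
  -- One family of functionals per element of `X` on the skeleton, detecting that element; `V` is
  -- the product of copies of `k` indexed by these elements.
  have h : ∀ i : Σ T : Skel U, X.obj (op T.obj), ∃ L : ∀ S : Skel U, Col X S.obj →ₗ[k] k,
      i.2 ≠ 0 → ∃ (S : Skel U) (a : i.1.obj ⟶ S.obj), L S (coeff hglobal hmul a i.2) ≠ 0 := by
    rintro ⟨T, x⟩
    by_cases hx : x = 0
    · exact ⟨0, fun h => absurd hx h⟩
    · obtain ⟨S, a, ha⟩ := exists_coeff_ne_zero hglobal hmul hX hx
      obtain ⟨L, hL⟩ : ∃ L : Col X S.obj →ₗ[k] k, L (coeff hglobal hmul a x) ≠ 0 := by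
        by_contra! hL
        exact ha ((Module.forall_dual_apply_eq_zero_iff k _).1 hL)
      exact ⟨Pi.single S L, fun _ => ⟨S, a, by rwa [Pi.single_eq_same]⟩⟩
  choose L hL using h
  let M : ∀ S : Skel U, Col X S.obj →ₗ[k] ((Σ T : Skel U, X.obj (op T.obj)) → k) :=
    fun S => LinearMap.pi fun i => L i S
  refine ⟨_, inferInstance, inferInstance, free.lift hglobal hmul M, (mono_iff _).2 fun A => ?_⟩
  rw [injective_iff_map_eq_zero]
  intro x hx
  obtain ⟨T, ⟨f⟩⟩ := exists_skel hglobal A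
  let i : T.obj ≅ A := isoOf f
  have hy : X.map i.hom.op x = 0 := by
    by_contra hy
    obtain ⟨S, a, ha⟩ := hL ⟨T, X.map i.hom.op x⟩ hy
    refine ha ?_
    have h1 := free.val_lift hglobal hmul M (X.map i.hom.op x) a
    rw [naturality_apply, hx, map_zero, map_zero] at h1
    exact (congrFun h1 ⟨T, X.map i.hom.op x⟩).symm
  rw [← map_id_apply X x, ← i.inv_hom_id, map_comp_apply, hy, map_zero]

/-- Every object is a quotient of a free object. -/
theorem exists_epi_free (hglobal : IsGlobalFamily U) (X : AU k U) :
    ∃ (V : Type u) (_ : AddCommGroup V) (_ : Module k V) (f : free k U V ⟶ X), Epi f := by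
  classical
  -- A single `V` serves all `S`, as the generators at `S` use only the component at `S`.
  refine ⟨∀ S : Skel U, X.obj (op S.obj), inferInstance, inferInstance,
    free.desc fun S => LinearMap.proj S, (epi_iff _).2 fun A x => ?_⟩
  obtain ⟨S, ⟨f⟩⟩ := exists_skel hglobal A
  let i : S.obj ≅ A := isoOf f
  refine ⟨(free k U _).map i.inv.op (free.gen S (Pi.single S (X.map i.hom.op x))), ?_⟩
  rw [free.desc_app_map_gen, LinearMap.proj_apply, Pi.single_eq_same, ← map_comp_apply,
    i.inv_hom_id, map_id_apply]

theorem projective_iff [CharZero k] (hglobal : IsGlobalFamily U) (hmul : IsMultiplicative U)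
    (X : AU k U) :
    Projective X ↔ IsTorsionFree X ∧ Injective X := by
  constructor
  · intro hX
    obtain ⟨V, _, _, p, _⟩ := exists_epi_free hglobal X
    obtain ⟨s, hs⟩ := hX.factors (𝟙 X) p
    have : Mono s := mono_of_mono_fac hs
    constructor
    · rintro G x ⟨H, f, hf⟩
      refine (mono_iff s).1 inferInstance G ?_
      rw [map_zero]
      refine free_isTorsionFree G _ ⟨H, f, ?_⟩
      rw [← naturality_apply, hf, map_zero]
    · refine ⟨fun g θ _ => ?_⟩
      obtain ⟨h, hh⟩ := (free_injective hglobal hmul (V := V)).factors (g ≫ s) θ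
      exact ⟨h ≫ p, by rw [← Category.assoc, hh, Category.assoc, hs, Category.comp_id]⟩
  · rintro ⟨htf, hX⟩
    obtain ⟨V, _, _, s, _⟩ := exists_mono_free hglobal hmul htf
    obtain ⟨p, hp⟩ := hX.factors (𝟙 X) s
    refine ⟨fun f q _ => ?_⟩
    obtain ⟨h, hh⟩ := (free_projective (k := k) (U := U) (V := V)).factors (p ≫ f) q
    exact ⟨s ≫ h, by rw [Category.assoc, hh, ← Category.assoc, hp, Category.id_comp]⟩

/-- Yoneda: a map out of `e k G` is an element of the value at `G`, and elements lift along
surjections. -/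
theorem e_projective (G : U.FullSubcategory) : Projective (e k G) where
  factors {B A} f p _ := by
    obtain ⟨b, hb⟩ := (epi_iff p).1 inferInstance G (f.app (op G) (Finsupp.single (𝟙 G) (1 : k)))
    refine ⟨{ app := fun T => ModuleCat.ofHom
                (Finsupp.linearCombination k fun α : unop T ⟶ G => B.map α.op b)
              naturality := fun T T' g => ?_ }, ?_⟩
    · ext : 1
      refine Finsupp.lhom_ext fun α c => ?_
      change Finsupp.linearCombination k _ (Finsupp.mapDomain _ (Finsupp.single α c)) =
        B.map g (Finsupp.linearCombination k _ (Finsupp.single α c))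
      rw [Finsupp.mapDomain_single, Finsupp.linearCombination_single,
        Finsupp.linearCombination_single, map_smul]
      exact congrArg _ (map_comp_apply B g.unop α b)
    · ext T : 3
      refine Finsupp.lhom_ext' fun α => LinearMap.ext_ring ?_
      change p.app T (Finsupp.linearCombination k _ (Finsupp.single α (1 : k))) = f.app T _
      rw [Finsupp.linearCombination_single, one_smul]
      refine (naturality_apply p α b).trans ?_
      rw [hb]
      refine (naturality_apply f α _).symm.trans (congrArg _ ?_)
      refine (Finsupp.mapDomain_single).trans ?_
      rw [Category.comp_id]
      rfl

end AU

theorem mainTheorem9 (k : Type u) [Field k] [CharZero k] (U : ObjectProperty OutGrp)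
    (hglobal : OutGrp.IsGlobalFamily U) (hmul : OutGrp.IsMultiplicative U) :
    (∀ X : AU k U, Projective X ↔ (AU.IsTorsionFree X ∧ Injective X)) ∧
      ∀ G : U.FullSubcategory, Injective (AU.e k G) :=
  ⟨AU.projective_iff hglobal hmul, fun G =>
    ((AU.projective_iff hglobal hmul _).1 (AU.e_projective G)).2⟩
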